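/- Let $k\ge 1$, $n=2k+1$, and let $M=\{c\in\mathbb R^n: c_i>0\}$ be the phase space of the periodic Volterra lattice (site indices are taken modulo $n$), with the quadratic and cubic Poisson tensors $$P^{ij}=c_ic_j(\delta_{i+1,j}-\delta_{j+1,i}),$$ $$Q^{ij}=c_ic_j(c_i+c_j)(\delta_{i+1,j}-\delta_{j+1,i})+c_ic_{i+1}c_{i+2}\,\delta_{i+2,j}-c_ic_{i-1}c_{i-2}\,\delta_{i-2,j}.$$ For a tensor $A$ and functions $f,g$ write $(A\,df)^i=\sum_jA^{ij}\partial f/\partial c_j$ and $\{f,g\}_A=\langle df,A\,dg\rangle$. Put $\pi=(c_1\cdots c_n)^{1/2}$. Let $J_j$ be the sum of the monomials $c_{l_1}\cdots c_{l_j}$ over all sets $\{l_1,\dots,l_j\}$ of $j$ sites no two of which are neighbours modulo $n$, and put $\mathcal H_j=J_j/\pi$. Put $$h(\nu)=\sum_{j=0}^k(-1)^j\nu^{k-j}\mathcal H_j,\quad Z=-\frac1{\mathcal H_0}\,(c_1\partial_{c_1}+c_n\partial_{c_n}),\quad X=Q\,d\mathcal H_0,\quad \widetilde Q=Q-X\wedge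 Z,$$ where $(X\wedge Z)^{ij}=X^iZ^j-Z^iX^j$. Let $$\Delta(\nu)=Z(h(\nu))=\sum_{j=0}^k(-1)^j\nu^{k-j}Z(\mathcal H_j),\qquad p_k=(-1)^k\Delta(0).$$ Then the following hold. 1. On $M$ one has $p_k>0$ and $Y:=P\,d\log p_k=c_1\partial_{c_1}-c_n\partial_{c_n}$. 2. At every point of $M$ the polynomial $\Delta$ is monic of degree $k$ with $k$ distinct positive roots $\nu_1<\dots<\nu_k$. With $f_i=h(\nu_i)=\sum_{j=0}^k(-1)^j\nu_i^{\,k-j}\mathcal H_j$, regarded as a function on $M$, the function $Y(f_i)+Y^2(f_i)$ vanishes nowhere on $M$. 3. The functions $$\eta_i=\log\nu_i,\qquad \psi_i=\log\bigl|\,Y(f_i)+Y^2(f_i)\,\bigr|,\qquad i=1,\dots,k,$$ form a set of canonical Darboux–Nijenhuis coordinates on every symplectic leaf $S$ of $P$ in $M$. That is: * near every point of $S$ they are the components of a smooth chart of $S$ (with smooth inverse); * on $S$ one has $\{\eta_i,\eta_j\}_P=0$, $\{\psi_i,\psi_j\}_P=0$ and $\{\psi_i,\eta_j\}_P=\delta_{ij}$;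 * at every point of $S$, $\widetilde Q$ descends to $S$, so that the Nijenhuis tensor $N=\widetilde Q|_S\circ(P|_S)^{-1}$ is defined on the tangent space of $S$, and $N^*d\eta_i=\nu_i\,d\eta_i$ and $N^*d\psi_i=\nu_i\,d\psi_i$. -/

import Mathlib

open scoped ContDiff

noncomputable section

namespace Volterra

section PoissonGeometry

variable {ι : Type*} [Fintype ι] [DecidableEq ι]

/-- The components `∂f/∂c_i` of the differential of `f` at `c`. -/
def grad (f : (ι → ℝ) → ℝ) (c : ι → ℝ) : ι → ℝ :=
  fun i => fderiv ℝ f c (Pi.single i 1)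

/-- The Lie derivative of the function `f` along the vector field `X`. -/
def lie (X : (ι → ℝ) → ι → ℝ) (f : (ι → ℝ) → ℝ) : (ι → ℝ) → ℝ :=
  fun c => fderiv ℝ f c (X c)

/-- The vector field `A df`, with components `∑ j, A^{ij} ∂f/∂c_j`. -/
def sharp (A : (ι → ℝ) → Matrix ι ι ℝ) (f : (ι → ℝ) → ℝ) : (ι → ℝ) → ι → ℝ :=
  fun c => (A c).mulVec (grad f c)

/-- The bracket `{f, g}_A = ⟨df, A dg⟩`. -/
def bracket (A : (ι → ℝ) → Matrix ι ι ℝ) (f g : (ι → ℝ) → ℝ) : (ι → ℝ) → ℝ :=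
  fun c => dotProduct (grad f c) (sharp A g c)

/-- The bivector `X ∧ Z`, with components `X^i Z^j - Z^i X^j`. -/
def wedge (X Z : (ι → ℝ) → ι → ℝ) (c : ι → ℝ) : Matrix ι ι ℝ :=
  Matrix.of fun i j => X c i * Z c j - Z c i * X c j

/-- The characteristic space of the bivector `A` at `c`, that is the image of
`A c : T* → T`. It is the tangent space at `c` of the symplectic leaf through `c`. -/
def charSpace (A : (ι → ℝ) → Matrix ι ι ℝ) (c : ι → ℝ) : Submodule ℝ (ι → ℝ) :=
  LinearMap.range (A c).mulVecLin

/-- The symplectic leaf through `c₀` of the bivector `A` on the open set `M`: the points of `M`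
that can be reached from `c₀` along smooth curves in `M` that are everywhere tangent to the
characteristic distribution of `A`. -/
def symplecticLeaf (A : (ι → ℝ) → Matrix ι ι ℝ) (M : Set (ι → ℝ)) (c₀ : ι → ℝ) :
    Set (ι → ℝ) :=
  {c₁ | ∃ γ : ℝ → ι → ℝ, ContDiff ℝ ∞ γ ∧ γ 0 = c₀ ∧ γ 1 = c₁ ∧
    ∀ t ∈ Set.Icc (0 : ℝ) 1, γ t ∈ M ∧ deriv γ t ∈ charSpace A (γ t)}

/-- `N` is the value at `c` of the recursion operator `N = B ∘ A⁻¹` that the bivectors `A` and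
`B` induce on the tangent space of the symplectic leaf of `A` through `c`. It is unique, since
`A c` maps onto that space; it exists if and only if `B c` descends to the leaf. -/
def IsRecursionOperator (A B : (ι → ℝ) → Matrix ι ι ℝ) (c : ι → ℝ)
    (N : charSpace A c →ₗ[ℝ] charSpace A c) : Prop :=
  ∀ α : ι → ℝ, ((N ((A c).mulVecLin.rangeRestrict α) : charSpace A c) : ι → ℝ) = (B c).mulVec α

/-- The functions `x₁, …, x_k, y₁, …, y_k` are Darboux–Nijenhuis coordinates on the symplectic
leaf `S` of `A`, with eigenvalues `ev₁, …, ev_k` of the Nijenhuis tensor `N = B ∘ A⁻¹` of `S`. -/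
structure IsDarbouxNijenhuis {k : ℕ} (A B : (ι → ℝ) → Matrix ι ι ℝ) (S : Set (ι → ℝ))
    (ev x y : Fin k → (ι → ℝ) → ℝ) : Prop where
  /-- Near every point of `S`, the functions `x, y` are the components of a chart of `S` with
  smooth inverse. -/
  chart : ∀ c ∈ S, ∃ (U : Set (ι → ℝ)) (V : Set ((Fin k → ℝ) × (Fin k → ℝ)))
    (g : (Fin k → ℝ) × (Fin k → ℝ) → ι → ℝ),
    IsOpen U ∧ c ∈ U ∧ IsOpen V ∧
    (∀ i, ContDiffOn ℝ ∞ (x i) U) ∧ (∀ i, ContDiffOn ℝ ∞ (y i) U) ∧ ContDiffOn ℝ ∞ g V ∧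
    Set.MapsTo (fun p => (fun i => x i p, fun i => y i p)) (S ∩ U) V ∧
    Set.MapsTo g V (S ∩ U) ∧
    Set.InvOn g (fun p => (fun i => x i p, fun i => y i p)) (S ∩ U) V
  bracket_x_x : ∀ c ∈ S, ∀ i j, bracket A (x i) (x j) c = 0
  bracket_y_y : ∀ c ∈ S, ∀ i j, bracket A (y i) (y j) c = 0
  bracket_y_x : ∀ c ∈ S, ∀ i j, bracket A (y i) (x j) c = if i = j then 1 else 0
  /-- `N* dx_i = ev_i dx_i` and `N* dy_i = ev_i dy_i` on the tangent spaces of `S`. -/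
  nijenhuis : ∀ c ∈ S, ∃ N : charSpace A c →ₗ[ℝ] charSpace A c, IsRecursionOperator A B c N ∧
    ∀ (i : Fin k) (v : charSpace A c),
      fderiv ℝ (x i) c (N v) = ev i c * fderiv ℝ (x i) c v ∧
      fderiv ℝ (y i) c (N v) = ev i c * fderiv ℝ (y i) c v

end PoissonGeometry

section Lattice

variable (k : ℕ)

/-- Points `(c_1, …, c_n)` with `n = 2k+1`. The sites `1, …, n` are the elements `0, …, 2k` of
`Fin (2k+1)`, whose addition is modulo `n`: the lattice is periodic. -/
abbrev Config : Type := Fin (2 * k + 1) → ℝ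

/-- The phase space `c_i > 0`. -/
def phaseSpace : Set (Config k) := {c | ∀ i, 0 < c i}

/-- The quadratic Poisson tensor. -/
def tensorP (c : Config k) : Matrix (Fin (2 * k + 1)) (Fin (2 * k + 1)) ℝ :=
  Matrix.of fun i j => c i * c j * ((if i + 1 = j then 1 else 0) - (if j + 1 = i then 1 else 0))

/-- The cubic Poisson tensor. -/
def tensorQ (c : Config k) : Matrix (Fin (2 * k + 1)) (Fin (2 * k + 1)) ℝ :=
  Matrix.of fun i j =>
    c i * c j * (c i + c j) * ((if i + 1 = j then 1 else 0) - (if j + 1 = i then 1 else 0))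
      + c i * c (i + 1) * c (i + 2) * (if i + 2 = j then 1 else 0)
      - c i * c (i - 1) * c (i - 2) * (if i - 2 = j then 1 else 0)

/-- `J_j`: the sum of the monomials `c_{l_1} ⋯ c_{l_j}` over the sets of `j` sites that contain
no two neighbouring sites of the periodic lattice. -/
def J (j : ℕ) (c : Config k) : ℝ :=
  ∑ s ∈ (Finset.univ : Finset (Finset (Fin (2 * k + 1)))) with
    s.card = j ∧ ∀ i ∈ s, i + 1 ∉ s, ∏ i ∈ s, c i

/-- `π = (c_1 ⋯ c_n)^{1/2}`. -/
def rootProd (c : Config k) : ℝ := Real.sqrt (∏ i, c i)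

/-- The Hamiltonians `𝓗_j = J_j / π`. -/
def ham (j : ℕ) (c : Config k) : ℝ := J k j c / rootProd k c

/-- The Casimir polynomial `H(μ)/μ = ∑_j (-1)^j 𝓗_j ν^{k-j}` of the pencil `Q - ν P`, at the
value `ν = μ²` of the parameter. -/
def casimir (ν : ℝ) (c : Config k) : ℝ :=
  ∑ j ∈ Finset.range (k + 1), (-1) ^ j * ν ^ (k - j) * ham k j c

/-- `Z = -(1/𝓗_0) (c_1 ∂_{c_1} + c_n ∂_{c_n})`. -/
def fieldZ (c : Config k) : Config k :=
  -(1 / ham k 0 c) •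
    (Pi.single 0 (c 0) + Pi.single (Fin.last (2 * k)) (c (Fin.last (2 * k))))

/-- `X = Q d𝓗_0`. -/
def fieldX : Config k → Config k := sharp (tensorQ k) (ham k 0)

/-- The deformed tensor `Q - X ∧ Z`, which restricts to the symplectic leaves of `P`. -/
def tensorQdef (c : Config k) : Matrix (Fin (2 * k + 1)) (Fin (2 * k + 1)) ℝ :=
  tensorQ k c - wedge (fieldX k) (fieldZ k) c

/-- `Δ(ν) = ∑_j (-1)^j Z(𝓗_j) ν^{k-j}`, the Lie derivative along `Z` of the Casimir
polynomial. -/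
def minPol (c : Config k) : Polynomial ℝ :=
  ∑ j ∈ Finset.range (k + 1),
    Polynomial.monomial (k - j) ((-1) ^ j * lie (fieldZ k) (ham k j) c)

/-- `p_k`: the constant term of `Δ` up to the sign `(-1)^k`, that is the product of the roots. -/
def lastCoeff (c : Config k) : ℝ := (-1) ^ k * (minPol k c).coeff 0

/-- `Y = P d log p_k`. -/
def fieldY : Config k → Config k := sharp (tensorP k) (fun c => Real.log (lastCoeff k c))

/-- The real roots `ν_1 ≤ ν_2 ≤ …` of `Δ` in increasing order. -/
def root (i : Fin k) (c : Config k) : ℝ :=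
  ((minPol k c).roots.sort (· ≤ ·)).getD i 0

/-- The function `∑_j (-1)^j ν_i^{k-j} 𝓗_j`: the Casimir polynomial at `ν = ν_i`. -/
def casimirAtRoot (i : Fin k) (c : Config k) : ℝ := casimir k (root k i c) c

/-- The argument `Y(f_i) + Y(Y(f_i))` of the logarithm in `ψ_i`, for `f_i` the Casimir
polynomial at `ν = ν_i`. -/
def psiArg (i : Fin k) (c : Config k) : ℝ :=
  lie (fieldY k) (casimirAtRoot k i) c + lie (fieldY k) (lie (fieldY k) (casimirAtRoot k i)) c

/-- `η_i = log ν_i`. -/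
def eta (i : Fin k) (c : Config k) : ℝ := Real.log (root k i c)

/-- `ψ_i = log |Y(f_i) + Y(Y(f_i))|`. -/
def psi (i : Fin k) (c : Config k) : ℝ := Real.log |psiArg k i c|

end Lattice

end Volterra

end

/-! Put y = -c/ν and let I be the independence polynomial of the n-cycle, so that h(ν) = ν^k I(y)/π
(`casimir_eq`). Write φ_S for the value I(y) after the sites in S are deleted. Sites are labelled as
in `Fin`: 0 and l = 2k are neighbours. Up to a factor, Z scales these two sites; an independent set
contains at most one of them, so Z(𝓗_j) is J_j with both deleted and Δ(ν) = ν^k φ_{0,l}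
(`lie_fieldZ_ham`, `eval_minPol`). This belongs to a path, and deletion of end sites gives a
two-step recursion as for orthogonal polynomials. The roots of Δ are therefore real, simple and
positive, and φ_{l} does not vanish at them.

The main algebraic fact is that at a root ν of Δ the differentials, at fixed ν, of φ_{l}/π and
φ_{0,l}/π are eigencovectors of the pair (Q̃, P) with eigenvalue ν (`tensorQdef_mulVec_grad_phi`).
By `occ_identity`, I(y)/π is a Casimir of Q - νP. Deleting sites spoils this only at the seam
between l and 0, and at a root of Δ the defect is a multiple of Z. The wedge correction adds another
multiple of Z, and pairing with d log(c_1⋯c_n), which is annihilated by P and Q̃, shows that the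
total multiple is zero. Implicit differentiation of φ_{0,l} = 0 makes dν_i an eigencovector, hence
also dη_i.

The product p_k is the product of the c_i over alternate sites, so P d log p_k survives only at the
seam: Y scales c_0 by e^t and c_l by e^{-t}. The roots are unchanged, and f_i becomes e^t A + e^{-t}
B with A = ν_i^k φ_{l}/π. Hence Y(f_i) + Y²(f_i) = 2A and Y(ψ_i) = 1 (`psiArg_eq`,
`lie_fieldY_psi`), and dψ_i is again an eigencovector.

Both tensors are skew, so eigencovectors with different eigenvalues have zero P-bracket. Since log
p_k = Σ η_j, the equation Y(ψ_i) = 1 reduces to {ψ_i, η_i}_P = 1. These brackets give 2k independent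
differentials on the leaves, which are the level sets of c_1⋯c_n (`symplecticLeaf_eq`), and the
inverse function theorem gives the charts. -/

namespace Volterra

/-! ### Independence polynomial of the cycle and the Casimir identity -/

open Finset

/-- The independence polynomial of the cycle of length `2k+1`: the sum of `∏ i ∈ s, y i` over the
sets `s` that contain no two neighbouring sites. -/
def indepPoly (k : ℕ) (y : Config k) : ℝ :=
  ∑ s ∈ (univ : Finset (Finset (Fin (2 * k + 1)))) with ∀ i ∈ s, i + 1 ∉ s, ∏ i ∈ s, y i

/-- The configuration obtained from `y` by setting the coordinates in `S` to zero. -/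
def mask {k : ℕ} (S : Finset (Fin (2 * k + 1))) (y : Config k) : Config k :=
  fun i => if i ∈ S then 0 else y i

variable {k : ℕ}

theorem mask_mask (S T : Finset (Fin (2 * k + 1))) (y : Config k) :
    mask S (mask T y) = mask (S ∪ T) y := by
  ext i
  simp only [mask, mem_union]
  split_ifs <;> tauto

theorem mask_empty (y : Config k) : mask ∅ y = y := by
  ext i
  simp [mask]

theorem mask_smul (S : Finset (Fin (2 * k + 1))) (r : ℝ) (y : Config k) :
    mask S (r • y) = r • mask S y := by
  ext i
  simp [mask]

theorem prod_mask (S s : Finset (Fin (2 * k + 1))) (y : Config k) :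
    ∏ i ∈ s, mask S y i = if Disjoint s S then ∏ i ∈ s, y i else 0 := by
  split_ifs with h
  · exact prod_congr rfl fun i hi => if_neg (disjoint_left.1 h hi)
  · obtain ⟨i, hi, hi'⟩ := not_disjoint_iff.1 h
    exact prod_eq_zero hi (if_pos hi')

theorem indepPoly_mask (S : Finset (Fin (2 * k + 1))) (y : Config k) :
    indepPoly k (mask S y) =
      ∑ s ∈ (univ : Finset (Finset (Fin (2 * k + 1)))) with
        (∀ i ∈ s, i + 1 ∉ s) ∧ Disjoint s S, ∏ i ∈ s, y i := by
  rw [indepPoly, ← filter_filter, sum_filter (p := fun s => Disjoint s S)]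
  exact sum_congr rfl fun s _ => prod_mask S s y

theorem site_two : (2 : Fin (2 * k + 1)) = 1 + 1 := by
  apply Fin.ext
  simp only [Fin.val_add, Fin.coe_ofNat_eq_mod]
  rw [← Nat.add_mod]

theorem site_three : (3 : Fin (2 * k + 1)) = 1 + 1 + 1 := by
  rw [← site_two]
  apply Fin.ext
  simp only [Fin.val_add, Fin.coe_ofNat_eq_mod]
  rw [← Nat.add_mod]

theorem site_add_one_add_one (i : Fin (2 * k + 1)) : i + 1 + 1 = i + 2 := by
  rw [site_two, add_assoc]

theorem site_sub_two_add_one (i : Fin (2 * k + 1)) : i - 2 + 1 = i - 1 := by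
  rw [site_two]; abel

theorem site_sub_one_sub_one (i : Fin (2 * k + 1)) : i - 1 - 1 = i - 2 := by
  rw [site_two]; abel

theorem site_add_one_ne (hk : 1 ≤ k) (i : Fin (2 * k + 1)) : i + 1 ≠ i := by
  intro h
  have h1 : (1 : Fin (2 * k + 1)) = 0 := by simpa using h
  have := congrArg Fin.val h1
  rw [Fin.val_one', Fin.val_zero, Nat.mod_eq_of_lt (by omega)] at this
  omega

theorem site_add_two_ne (hk : 1 ≤ k) (i : Fin (2 * k + 1)) : i + 2 ≠ i := by
  intro h
  have h1 : (2 : Fin (2 * k + 1)) = 0 := by simpa using h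
  have := congrArg Fin.val h1
  rw [Fin.val_zero, Fin.coe_ofNat_eq_mod, Nat.mod_eq_of_lt (by omega)] at this
  omega

theorem site_add_three_ne (hk : 2 ≤ k) (i : Fin (2 * k + 1)) : i + 3 ≠ i := by
  intro h
  have h1 : (3 : Fin (2 * k + 1)) = 0 := by simpa using h
  have := congrArg Fin.val h1
  rw [Fin.val_zero, Fin.coe_ofNat_eq_mod, Nat.mod_eq_of_lt (by omega)] at this
  omega

/-- Deletion–contraction at the site `i`. -/
theorem indepPoly_rec (hk : 1 ≤ k) (i : Fin (2 * k + 1)) (y : Config k) :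
    indepPoly k y = indepPoly k (mask {i} y) + y i * indepPoly k (mask {i - 1, i, i + 1} y) := by
  have hne := site_add_one_ne hk
  have hne' : i - 1 ≠ i := fun h => hne (i - 1) (by rw [sub_add_cancel, h])
  rw [indepPoly_mask, indepPoly_mask, indepPoly,
    ← sum_filter_not_add_sum_filter _ (fun s => i ∈ s), filter_filter, filter_filter]
  congr 1
  · simp
  · rw [mul_sum]
    refine sum_bij' (fun s _ => s.erase i) (fun s _ => insert i s) ?_ ?_ ?_ ?_ ?_
    · intro s hs
      simp only [mem_filter, mem_univ, true_and] at hs ⊢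
      obtain ⟨hs, hi⟩ := hs
      refine ⟨fun j hj hj' => hs j (mem_of_mem_erase hj) (mem_of_mem_erase hj'), ?_⟩
      rw [disjoint_left]
      intro j hj hj'
      have hj1 := mem_of_mem_erase hj
      have hj2 := ne_of_mem_erase hj
      simp only [mem_insert, mem_singleton] at hj'
      rcases hj' with rfl | rfl | rfl
      · exact hs _ hj1 (by rwa [sub_add_cancel])
      · exact hj2 rfl
      · exact hs _ hi hj1
    · intro s hs
      simp only [mem_filter, mem_univ, true_and] at hs ⊢
      obtain ⟨hs, hd⟩ := hs
      rw [disjoint_right] at hd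
      have h1 : i - 1 ∉ s := hd (by simp)
      have h2 : i + 1 ∉ s := hd (by simp)
      refine ⟨fun j hj => ?_, mem_insert_self i s⟩
      rw [mem_insert] at hj ⊢
      rintro (h | h)
      · have hj' : j = i - 1 := by rw [← h, add_sub_cancel_right]
        rcases hj with h' | h'
        · exact hne' (hj' ▸ h')
        · exact h1 (hj' ▸ h')
      · rcases hj with rfl | h'
        · exact h2 h
        · exact hs j h' h
    · intro s hs
      simp only [mem_filter, mem_univ, true_and] at hs
      exact insert_erase hs.2
    · intro s hs
      simp only [mem_filter, mem_univ, true_and] at hs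
      exact erase_insert fun h => disjoint_left.1 hs.2 h (by simp)
    · intro s hs
      simp only [mem_filter, mem_univ, true_and] at hs
      exact (mul_prod_erase s y hs.2).symm

/-- Deletion–contraction with some sites already deleted. The sets `T` and `U` enter through
membership, so they can be written in any shape, even if listed sites coincide modulo n. -/
theorem indepPoly_mask_rec (hk : 1 ≤ k) {S T U : Finset (Fin (2 * k + 1))} {i : Fin (2 * k + 1)}
    (y : Config k) (hi : i ∉ S) (hT : ∀ j, j ∈ T ↔ j ∈ S ∨ j = i)
    (hU : ∀ j, j ∈ U ↔ j ∈ S ∨ j = i - 1 ∨ j = i ∨ j = i + 1) :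
    indepPoly k (mask S y) = indepPoly k (mask T y) + y i * indepPoly k (mask U y) := by
  have hT' : T = {i} ∪ S := by
    ext j; rw [hT]; simp only [mem_union, mem_singleton]; tauto
  have hU' : U = {i - 1, i, i + 1} ∪ S := by
    ext j; rw [hU]; simp only [mem_union, mem_insert, mem_singleton]; tauto
  rw [indepPoly_rec hk i (mask S y), mask_mask, mask_mask, ← hT', ← hU']
  simp [mask, hi]

/-- The logarithmic derivative term `y_j ∂I/∂y_j` of the independence polynomial. -/
def occ (k : ℕ) (y : Config k) (j : Fin (2 * k + 1)) : ℝ :=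
  y j * indepPoly k (mask {j - 1, j, j + 1} y)

/-- An independent set contains neither of two neighbours or exactly one of them. -/
theorem indepPoly_eq_mask_pair (hk : 1 ≤ k) (y : Config k) (j : Fin (2 * k + 1)) :
    indepPoly k y = indepPoly k (mask {j, j + 1} y) + occ k y j + occ k y (j + 1) := by
  have h1 := indepPoly_rec hk j y
  have h2 := indepPoly_mask_rec hk (S := {j}) (T := {j, j + 1})
    (U := {j + 1 - 1, j + 1, j + 1 + 1}) (i := j + 1) y
    (by simpa using site_add_one_ne hk j) (by simp) (by
      intro i; simp only [mem_insert, mem_singleton, add_sub_cancel_right]; tauto)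
  rw [h1, h2, occ, occ]
  ring

theorem occ_add_occ_sub (hk : 1 ≤ k) (y : Config k) (i : Fin (2 * k + 1)) :
    y i * occ k y (i + 1) + y (i + 1) * (occ k y (i + 1) + occ k y (i + 2) - indepPoly k y)
        + occ k y (i + 1) =
      y i * y (i + 1) * (indepPoly k (mask {i, i + 1, i + 2} y)
        - indepPoly k (mask {i - 1, i, i + 1, i + 2} y)) := by
  have e2 : i + 1 + 1 = i + 2 := site_add_one_add_one i
  have h1 := indepPoly_eq_mask_pair hk y (i + 1)
  rw [e2] at h1
  have h2 := indepPoly_mask_rec hk (S := {i + 1, i + 2}) (T := {i, i + 1, i + 2})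
    (U := {i - 1, i, i + 1, i + 2}) (i := i) y
    (by
      simp only [mem_insert, mem_singleton, not_or]
      exact ⟨(site_add_one_ne hk i).symm, (site_add_two_ne hk i).symm⟩)
    (by intro j; simp only [mem_insert, mem_singleton]; tauto)
    (by intro j; simp only [mem_insert, mem_singleton]; tauto)
  have h3 : occ k y (i + 1) = y (i + 1) * indepPoly k (mask {i, i + 1, i + 2} y) := by
    rw [occ, add_sub_cancel_right, e2]
  rw [h3] at h1 ⊢
  linear_combination (-y (i + 1)) * h1 - y (i + 1) * h2

theorem occ_sub_occ_sub (hk : 1 ≤ k) (y : Config k) (i : Fin (2 * k + 1)) :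
    y i * occ k y (i - 1) + y (i - 1) * (occ k y (i - 1) + occ k y (i - 2) - indepPoly k y)
        + occ k y (i - 1) =
      y i * y (i - 1) * (indepPoly k (mask {i - 2, i - 1, i} y)
        - indepPoly k (mask {i - 2, i - 1, i, i + 1} y)) := by
  have e2 : i - 2 + 1 = i - 1 := site_sub_two_add_one i
  have e3 : i - 1 - 1 = i - 2 := site_sub_one_sub_one i
  have h1 := indepPoly_eq_mask_pair hk y (i - 2)
  rw [e2] at h1
  have h2 := indepPoly_mask_rec hk (S := {i - 2, i - 1}) (T := {i - 2, i - 1, i})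
    (U := {i - 2, i - 1, i, i + 1}) (i := i) y
    (by
      simp only [mem_insert, mem_singleton, not_or]
      constructor
      · intro h
        exact site_add_two_ne hk i (by nth_rw 1 [h]; rw [sub_add_cancel])
      · intro h
        exact site_add_one_ne hk i (by nth_rw 1 [h]; rw [sub_add_cancel]))
    (by intro j; simp only [mem_insert, mem_singleton]; tauto)
    (by intro j; simp only [mem_insert, mem_singleton]; tauto)
  have h3 : occ k y (i - 1) = y (i - 1) * indepPoly k (mask {i - 2, i - 1, i} y) := by
    rw [occ, e3, sub_add_cancel]
  rw [h3] at h1 ⊢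
  linear_combination (-y (i - 1)) * h1 - y (i - 1) * h2

/-- For y = -c/ν this is the `i`-th component of (Q - νP) d(I(y)/π) = 0, up to a nonzero factor. The
two preceding lemmas evaluate the two sides of the site `i`; what remains is symmetric under
reflection at `i`. -/
theorem occ_identity (hk : 1 ≤ k) (y : Config k) (i : Fin (2 * k + 1)) :
    y i * (occ k y (i + 1) - occ k y (i - 1))
      + y (i + 1) * (occ k y (i + 1) + occ k y (i + 2) - indepPoly k y)
      - y (i - 1) * (occ k y (i - 1) + occ k y (i - 2) - indepPoly k y)
      + (occ k y (i + 1) - occ k y (i - 1)) = 0 := by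
  have h1 := occ_add_occ_sub hk y i
  have h2 := occ_sub_occ_sub hk y i
  suffices h : y (i + 1) * (indepPoly k (mask {i, i + 1, i + 2} y)
        - indepPoly k (mask {i - 1, i, i + 1, i + 2} y)) =
      y (i - 1) * (indepPoly k (mask {i - 2, i - 1, i} y)
        - indepPoly k (mask {i - 2, i - 1, i, i + 1} y)) by
    linear_combination h1 - h2 + y i * h
  -- For n = 3 the sites i - 1 and i + 2 coincide, so deletion–contraction at i - 1 is not
  -- available. All four masks then delete every site and both sides vanish.
  rcases hk.eq_or_lt with rfl | hk2
  · have e1 : ∀ i : Fin (2 * 1 + 1), ({i, i + 1, i + 2} : Finset (Fin (2 * 1 + 1))) = univ := by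
      decide
    have e2 : ∀ i : Fin (2 * 1 + 1),
        ({i - 1, i, i + 1, i + 2} : Finset (Fin (2 * 1 + 1))) = univ := by
      decide
    have e3 : ∀ i : Fin (2 * 1 + 1), ({i - 2, i - 1, i} : Finset (Fin (2 * 1 + 1))) = univ := by
      decide
    have e4 : ∀ i : Fin (2 * 1 + 1),
        ({i - 2, i - 1, i, i + 1} : Finset (Fin (2 * 1 + 1))) = univ := by
      decide
    rw [e4, e3, e2, e1]
    ring
  · have n3 := site_add_three_ne hk2
    have e2 : i - 2 + 1 = i - 1 := site_sub_two_add_one i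
    have e3 : i - 1 - 1 = i - 2 := site_sub_one_sub_one i
    have e4 : i + 1 + 1 = i + 2 := site_add_one_add_one i
    have a1 := indepPoly_mask_rec hk (S := {i, i + 1, i + 2}) (T := {i - 1, i, i + 1, i + 2})
      (U := {i - 2, i - 1, i, i + 1, i + 2}) (i := i - 1) y
      (by
        simp only [mem_insert, mem_singleton, not_or]
        refine ⟨fun h => site_add_one_ne hk (i - 1) ?_, fun h => site_add_two_ne hk (i - 1) ?_,
          fun h => n3 (i - 1) ?_⟩
        · rw [sub_add_cancel, h]
        · rw [← site_add_one_add_one, sub_add_cancel, h]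
        · rw [site_three, ← add_assoc, ← add_assoc, sub_add_cancel, e4, h])
      (by intro j; simp only [mem_insert, mem_singleton]; tauto)
      (by intro j; simp only [mem_insert, mem_singleton, sub_add_cancel, e3]; tauto)
    have a2 := indepPoly_mask_rec hk (S := {i - 2, i - 1, i}) (T := {i - 2, i - 1, i, i + 1})
      (U := {i - 2, i - 1, i, i + 1, i + 2}) (i := i + 1) y
      (by
        simp only [mem_insert, mem_singleton, not_or]
        refine ⟨fun h => n3 (i - 2) ?_, fun h => site_add_two_ne hk (i - 1) ?_,
          fun h => site_add_one_ne hk i h⟩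
        · rw [site_three, ← add_assoc, ← add_assoc, e2, sub_add_cancel, h]
        · rw [← site_add_one_add_one, sub_add_cancel, h])
      (by intro j; simp only [mem_insert, mem_singleton]; tauto)
      (by intro j; simp only [mem_insert, mem_singleton, add_sub_cancel_right, e4]; tauto)
    rw [a1, a2]
    -- Both sides are now y_{i-1} y_{i+1} times the value with the five sites i-2, …, i+2 deleted.
    ring

end Volterra

/-! ### Derivatives along exponential curves; Δ as an independence polynomial -/

namespace Volterra

open Finset

section PoissonGeometry

variable {ι : Type*}

/-- The curve through `c` that is the straight line with velocity `w` in the coordinates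
`log c_i`. -/
noncomputable def expCurve (w c : ι → ℝ) (t : ℝ) : ι → ℝ := fun i => Real.exp (t * w i) * c i

theorem expCurve_zero (w c : ι → ℝ) : expCurve w c 0 = c := by
  ext i
  simp [expCurve]

theorem fderiv_eq_dotProduct_grad [Fintype ι] [DecidableEq ι] (f : (ι → ℝ) → ℝ) (c v : ι → ℝ) :
    fderiv ℝ f c v = dotProduct (grad f c) v := by
  conv_lhs => rw [pi_eq_sum_univ' v, map_sum]
  refine Finset.sum_congr rfl fun i _ => ?_
  rw [map_smul, smul_eq_mul, mul_comm]
  congr 2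

theorem fderiv_eq_of_curve [Fintype ι] {f : (ι → ℝ) → ℝ} {γ : ℝ → ι → ℝ} {t d : ℝ} {v : ι → ℝ}
    (hf : DifferentiableAt ℝ f (γ t)) (hγ : HasDerivAt γ v t)
    (hd : HasDerivAt (fun s => f (γ s)) d t) : fderiv ℝ f (γ t) v = d :=
  (hf.hasFDerivAt.comp_hasDerivAt t hγ).unique hd

theorem hasDerivAt_expCurve (w c : ι → ℝ) (t : ℝ) :
    HasDerivAt (expCurve w c) (fun i => w i * expCurve w c t i) t := by
  rw [hasDerivAt_pi]
  intro i
  have h := (((hasDerivAt_id t).mul_const (w i)).exp).mul_const (c i)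
  exact h.congr_deriv (by simp only [expCurve, id]; ring)

theorem contDiff_expCurve [Fintype ι] (w c : ι → ℝ) : ContDiff ℝ ∞ (expCurve w c) := by
  rw [contDiff_pi]
  intro i
  unfold expCurve
  fun_prop

/-- Monomials and π are multiplied by exponentials along these curves, so directional derivatives
reduce to derivatives of explicit functions of one variable. -/
theorem fderiv_eq_of_expCurve [Fintype ι] {f : (ι → ℝ) → ℝ} {w c : ι → ℝ} {d : ℝ}
    (hf : DifferentiableAt ℝ f c) (hd : HasDerivAt (fun s => f (expCurve w c s)) d 0) :
    fderiv ℝ f c (fun i => w i * c i) = d := by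
  have h := hasDerivAt_expCurve w c 0
  simp only [expCurve_zero] at h
  have hf' : DifferentiableAt ℝ f (expCurve w c 0) := by rwa [expCurve_zero]
  have := fderiv_eq_of_curve hf' h hd
  rwa [expCurve_zero] at this

theorem mul_grad_eq_of_expCurve [Fintype ι] [DecidableEq ι] {f : (ι → ℝ) → ℝ} {c : ι → ℝ} {d : ℝ} (i : ι)
    (hf : DifferentiableAt ℝ f c)
    (hd : HasDerivAt (fun s => f (expCurve (Pi.single i 1) c s)) d 0) :
    c i * grad f c i = d := by
  rw [← fderiv_eq_of_expCurve hf hd, grad]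
  have : (fun j => (Pi.single i 1 : ι → ℝ) j * c j) = c i • (Pi.single i 1 : ι → ℝ) := by
    ext j
    rcases eq_or_ne j i with rfl | h
    · simp
    · simp [h]
  rw [this, map_smul, smul_eq_mul]

end PoissonGeometry

variable {k : ℕ}

theorem expCurve_mem_phaseSpace {c : Config k} (hc : c ∈ phaseSpace k) (w : Config k) (t : ℝ) :
    expCurve w c t ∈ phaseSpace k :=
  fun i => mul_pos (Real.exp_pos _) (hc i)

theorem isOpen_phaseSpace : IsOpen (phaseSpace k) := by
  have : phaseSpace k = ⋂ i, {c : Config k | 0 < c i} := by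
    ext c
    simp [phaseSpace]
  rw [this]
  exact isOpen_iInter_of_finite fun i => isOpen_lt continuous_const (continuous_apply i)

theorem rootProd_pos {c : Config k} (hc : c ∈ phaseSpace k) : 0 < rootProd k c :=
  Real.sqrt_pos.2 (prod_pos fun i _ => hc i)

theorem contDiff_prod_univ : ContDiff ℝ ∞ (fun c : Config k => ∏ i, c i) :=
  contDiff_prod fun i _ => contDiff_apply ℝ ℝ i

theorem contDiffAt_rootProd {c : Config k} (hc : c ∈ phaseSpace k) :
    ContDiffAt ℝ ∞ (rootProd k) c :=
  contDiff_prod_univ.contDiffAt.sqrt (prod_pos fun i _ => hc i).ne'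

theorem prod_expCurve (s : Finset (Fin (2 * k + 1))) (w c : Config k) (t : ℝ) :
    ∏ i ∈ s, expCurve w c t i = Real.exp (t * ∑ i ∈ s, w i) * ∏ i ∈ s, c i := by
  simp only [expCurve, prod_mul_distrib, ← Real.exp_sum, mul_sum]

theorem rootProd_expCurve (w c : Config k) (t : ℝ) :
    rootProd k (expCurve w c t) = Real.exp (t * (∑ i, w i) / 2) * rootProd k c := by
  rw [rootProd, prod_expCurve, Real.sqrt_mul (Real.exp_pos _).le, ← Real.exp_half, rootProd]

theorem contDiff_J (j : ℕ) : ContDiff ℝ ∞ (J k j) := by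
  unfold J
  exact ContDiff.sum fun s _ => contDiff_prod fun i _ => contDiff_apply ℝ ℝ i

theorem contDiff_indepPoly : ContDiff ℝ ∞ (indepPoly k) := by
  unfold indepPoly
  exact ContDiff.sum fun s _ => contDiff_prod fun i _ => contDiff_apply ℝ ℝ i

/-- An independent set is disjoint from its shift by one site. Hence J_0, …, J_k account for all
independent sets. -/
theorem two_mul_card_le_of_indep {s : Finset (Fin (2 * k + 1))} (hs : ∀ i ∈ s, i + 1 ∉ s) :
    2 * s.card ≤ 2 * k + 1 := by
  have hd : Disjoint s (s.image (· + 1)) := by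
    rw [disjoint_right]
    intro a ha
    obtain ⟨i, hi, rfl⟩ := mem_image.1 ha
    exact hs i hi
  have h := card_le_univ (s ∪ s.image (· + 1))
  rw [card_union_of_disjoint hd, card_image_of_injective _ (add_left_injective 1),
    Fintype.card_fin] at h
  omega

theorem sum_J_eq_indepPoly {ν : ℝ} (hν : ν ≠ 0) (d : Config k) :
    ∑ j ∈ range (k + 1), (-1) ^ j * ν ^ (k - j) * J k j d =
      ν ^ k * indepPoly k ((-ν⁻¹) • d) := by
  rw [indepPoly, ← sum_fiberwise_of_maps_to (t := range (k + 1)) (g := Finset.card), mul_sum]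
  · refine sum_congr rfl fun j hj => ?_
    rw [J, mul_sum, mul_sum, filter_filter]
    refine sum_congr (by ext s; simp [and_comm]) fun s hs => ?_
    have hs' : s.card = j := (mem_filter.1 hs).2.2
    have hj' : j ≤ k := by
      have := mem_range.1 hj
      omega
    simp only [Pi.smul_apply, smul_eq_mul, prod_mul_distrib, prod_const, hs']
    rw [neg_pow ν⁻¹, inv_pow, pow_sub₀ _ hν hj']
    ring
  · intro s hs
    have := two_mul_card_le_of_indep (mem_filter.1 hs).2
    rw [mem_range]
    omega

theorem casimir_eq {ν : ℝ} (hν : ν ≠ 0) (c : Config k) :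
    casimir k ν c = ν ^ k * indepPoly k ((-ν⁻¹) • c) / rootProd k c := by
  rw [← sum_J_eq_indepPoly hν, sum_div, casimir]
  exact sum_congr rfl fun j _ => (mul_div_assoc _ _ _).symm

theorem zero_ne_last (hk : 1 ≤ k) : (0 : Fin (2 * k + 1)) ≠ Fin.last (2 * k) := by
  rw [Ne, Fin.ext_iff, Fin.val_zero, Fin.val_last]
  omega

theorem last_add_one : Fin.last (2 * k) + 1 = 0 := Fin.last_add_one _

theorem zero_sub_one : (0 : Fin (2 * k + 1)) - 1 = Fin.last (2 * k) := by
  rw [← last_add_one, add_sub_cancel_right]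

theorem sum_single_add_single (hk : 1 ≤ k) {s : Finset (Fin (2 * k + 1))}
    (hs : ∀ i ∈ s, i + 1 ∉ s) :
    ∑ i ∈ s, (Pi.single 0 1 + Pi.single (Fin.last (2 * k)) 1 : Config k) i =
      if Disjoint s {0, Fin.last (2 * k)} then 0 else 1 := by
  have h0 := zero_ne_last hk
  simp only [Pi.add_apply, sum_add_distrib, disjoint_insert_right,
    disjoint_singleton_right]
  by_cases h : Fin.last (2 * k) ∈ s
  · have := hs _ h
    rw [last_add_one] at this
    simp [h, this]
  · by_cases h' : (0 : Fin (2 * k + 1)) ∈ s <;> simp [h, h']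

theorem J_expCurve (hk : 1 ≤ k) (j : ℕ) (c : Config k) (t : ℝ) :
    J k j (expCurve (Pi.single 0 1 + Pi.single (Fin.last (2 * k)) 1) c t) =
      J k j (mask {0, Fin.last (2 * k)} c) +
        Real.exp t * (J k j c - J k j (mask {0, Fin.last (2 * k)} c)) := by
  simp only [J, ← sum_sub_distrib, mul_sum, ← sum_add_distrib]
  refine sum_congr rfl fun s hs => ?_
  rw [prod_expCurve, sum_single_add_single hk (mem_filter.1 hs).2.2, prod_mask]
  split_ifs <;> simp

theorem fieldZ_eq (c : Config k) :
    fieldZ k c = (-(1 / ham k 0 c)) •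
      fun i => (Pi.single 0 1 + Pi.single (Fin.last (2 * k)) 1 : Config k) i * c i := by
  rw [fieldZ]
  congr 1
  ext i
  have h (j : Fin (2 * k + 1)) : (Pi.single j (c j) : Config k) i =
      (Pi.single j 1 : Config k) i * c i := by
    rcases eq_or_ne i j with rfl | h
    · simp
    · simp [h]
  rw [Pi.add_apply, h, h, Pi.add_apply, add_mul]

theorem J_zero (c : Config k) : J k 0 c = 1 := by
  rw [J, sum_eq_single ∅] <;> simp +contextual

theorem ham_zero (c : Config k) : ham k 0 c = 1 / rootProd k c := by
  rw [ham, J_zero]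

/-- Scaling the sites 0 and l by e^t multiplies π by e^t, as well as every monomial of J_j that
meets them. In J_j/π only the part that avoids both sites varies, as e^{-t}, and the prefactor
-1/𝓗_0 = -π in Z cancels its denominator and sign. -/
theorem lie_fieldZ_ham (hk : 1 ≤ k) (j : ℕ) {c : Config k} (hc : c ∈ phaseSpace k) :
    lie (fieldZ k) (ham k j) c = J k j (mask {0, Fin.last (2 * k)} c) := by
  have hπ := rootProd_pos hc
  have hdiff : DifferentiableAt ℝ (ham k j) c :=
    (((contDiff_J j).contDiffAt).div (contDiffAt_rootProd hc) hπ.ne').differentiableAt (by simp)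
  have hsum : ∑ i, (Pi.single 0 1 + Pi.single (Fin.last (2 * k)) 1 : Config k) i = 2 := by
    simp [sum_add_distrib, one_add_one_eq_two]
  rw [lie, fieldZ_eq, map_smul,
    fderiv_eq_of_expCurve (d := -(J k j (mask {0, Fin.last (2 * k)} c) / rootProd k c)) hdiff,
    ham_zero, smul_eq_mul]
  · field_simp
  · have : (fun s => ham k j (expCurve (Pi.single 0 1 + Pi.single (Fin.last (2 * k)) 1) c s)) =
        fun s => Real.exp (-s) * (J k j (mask {0, Fin.last (2 * k)} c) / rootProd k c) +
          (J k j c - J k j (mask {0, Fin.last (2 * k)} c)) / rootProd k c := by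
      ext s
      rw [ham, J_expCurve hk, rootProd_expCurve, hsum, mul_div_assoc, div_self two_ne_zero, mul_one,
        Real.exp_neg]
      have := (Real.exp_pos s).ne'
      field_simp
    rw [this]
    have h := (((hasDerivAt_neg (0 : ℝ)).exp).mul_const
      (J k j (mask {0, Fin.last (2 * k)} c) / rootProd k c)).add_const
      ((J k j c - J k j (mask {0, Fin.last (2 * k)} c)) / rootProd k c)
    simpa using h

/-- The value at `-c/ν` of the independence polynomial of the sites outside `S`. -/
noncomputable def phi (k : ℕ) (S : Finset (Fin (2 * k + 1))) (ν : ℝ) (c : Config k) : ℝ :=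
  indepPoly k (mask S ((-ν⁻¹) • c))

theorem eval_minPol (hk : 1 ≤ k) {ν : ℝ} (hν : ν ≠ 0) {c : Config k} (hc : c ∈ phaseSpace k) :
    (minPol k c).eval ν = ν ^ k * phi k {0, Fin.last (2 * k)} ν c := by
  rw [phi, mask_smul, ← sum_J_eq_indepPoly hν, minPol, Polynomial.eval_finsetSum]
  refine sum_congr rfl fun j _ => ?_
  rw [Polynomial.eval_monomial, lie_fieldZ_ham hk j hc]
  ring

theorem mask_smul_expCurve_single (S : Finset (Fin (2 * k + 1))) (r t : ℝ) (c : Config k)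
    (i : Fin (2 * k + 1)) {T : Finset (Fin (2 * k + 1))} (hT : i ∈ T) :
    mask T (mask S (r • expCurve (Pi.single i 1) c t)) = mask T (mask S (r • c)) := by
  ext j
  simp only [mask]
  split_ifs with h1 h2
  · rfl
  · rfl
  · have : j ≠ i := fun h => h1 (h ▸ hT)
    simp [expCurve, this]

theorem phi_expCurve_single (hk : 1 ≤ k) (S : Finset (Fin (2 * k + 1))) (ν t : ℝ) (c : Config k)
    (i : Fin (2 * k + 1)) :
    phi k S ν (expCurve (Pi.single i 1) c t) =
      (phi k S ν c - occ k (mask S ((-ν⁻¹) • c)) i) +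
        Real.exp t * occ k (mask S ((-ν⁻¹) • c)) i := by
  have h1 := indepPoly_rec hk i (mask S ((-ν⁻¹) • expCurve (Pi.single i 1) c t))
  have h2 := indepPoly_rec hk i (mask S ((-ν⁻¹) • c))
  rw [mask_smul_expCurve_single S _ _ _ i (by simp),
    mask_smul_expCurve_single S _ _ _ i (by simp)] at h1
  have h3 : mask S ((-ν⁻¹) • expCurve (Pi.single i 1) c t) i =
      Real.exp t * mask S ((-ν⁻¹) • c) i := by
    simp only [mask, expCurve, Pi.smul_apply, smul_eq_mul, Pi.single_eq_same, mul_one]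
    split_ifs
    · simp
    · ring
  rw [h3] at h1
  simp only [phi, occ]
  linear_combination h1 - h2

theorem contDiff_mask (S : Finset (Fin (2 * k + 1))) : ContDiff ℝ ∞ (mask (k := k) S) := by
  rw [contDiff_pi]
  intro i
  simp only [mask]
  split_ifs
  · exact contDiff_const
  · exact contDiff_apply ℝ ℝ i

theorem contDiffAt_phi (S : Finset (Fin (2 * k + 1))) {p : ℝ × Config k} (hp : p.1 ≠ 0) :
    ContDiffAt ℝ ∞ (fun p : ℝ × Config k => phi k S p.1 p.2) p := by
  have h : ContDiffAt ℝ ∞ (fun p : ℝ × Config k => (-p.1⁻¹) • p.2) p :=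
    (contDiffAt_fst.inv hp).neg.smul contDiffAt_snd
  exact (contDiff_indepPoly.comp (contDiff_mask S)).contDiffAt.comp p h

/-- φ_S is affine in each c_i with linear part `occ`; the term with 1/2 comes from the square root
in π. -/
theorem mul_grad_phi_div (hk : 1 ≤ k) (S : Finset (Fin (2 * k + 1))) {ν : ℝ} (hν : ν ≠ 0)
    {c : Config k} (hc : c ∈ phaseSpace k) (i : Fin (2 * k + 1)) :
    c i * grad (fun c => phi k S ν c / rootProd k c) c i =
      (occ k (mask S ((-ν⁻¹) • c)) i - phi k S ν c / 2) / rootProd k c := by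
  have hπ := rootProd_pos hc
  have hdiff : DifferentiableAt ℝ (fun c => phi k S ν c / rootProd k c) c := by
    refine ContDiffAt.differentiableAt (n := ∞) ?_ (by simp)
    refine ContDiffAt.div ?_ (contDiffAt_rootProd hc) hπ.ne'
    exact (contDiffAt_phi S (p := (ν, c)) hν).comp c (contDiffAt_const.prodMk contDiffAt_id)
  refine mul_grad_eq_of_expCurve i hdiff ?_
  have : (fun s => phi k S ν (expCurve (Pi.single i 1) c s) /
        rootProd k (expCurve (Pi.single i 1) c s)) =
      fun s => Real.exp (-s / 2) * ((phi k S ν c - occ k (mask S ((-ν⁻¹) • c)) i) / rootProd k c) +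
        Real.exp (s / 2) * (occ k (mask S ((-ν⁻¹) • c)) i / rootProd k c) := by
    ext s
    rw [phi_expCurve_single hk, rootProd_expCurve]
    have e1 : Real.exp s = Real.exp (s / 2) * Real.exp (s / 2) := by
      rw [← Real.exp_add, add_halves]
    have e2 : Real.exp (-s / 2) = (Real.exp (s / 2))⁻¹ := by rw [← Real.exp_neg, neg_div]
    have e4 : s * ∑ j, (Pi.single i 1 : Config k) j = s := by simp
    rw [e4, e1, e2]
    have := (Real.exp_pos (s / 2)).ne'
    field_simp
  rw [this]
  have h := ((((hasDerivAt_neg (0 : ℝ)).div_const 2).exp).mul_const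
      ((phi k S ν c - occ k (mask S ((-ν⁻¹) • c)) i) / rootProd k c)).add
      ((((hasDerivAt_id (0 : ℝ)).div_const 2).exp).mul_const
      (occ k (mask S ((-ν⁻¹) • c)) i / rootProd k c))
  refine h.congr_deriv ?_
  simp
  ring

end Volterra

/-! ### The deformed tensor and eigencovectors at the roots of Δ -/

namespace Volterra

open Finset Matrix

variable {k : ℕ}

theorem eq_sub_one_iff (i j : Fin (2 * k + 1)) : j + 1 = i ↔ i - 1 = j := by
  rw [sub_eq_iff_eq_add, eq_comm]

theorem eq_sub_two_iff (i j : Fin (2 * k + 1)) : j + 2 = i ↔ i - 2 = j := by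
  rw [sub_eq_iff_eq_add, eq_comm]

theorem tensorP_mulVec (c α : Config k) (i : Fin (2 * k + 1)) :
    (tensorP k c).mulVec α i = c i * (c (i + 1) * α (i + 1) - c (i - 1) * α (i - 1)) := by
  have e1 (j : Fin (2 * k + 1)) : j + 1 = i ↔ i - 1 = j := eq_sub_one_iff i j
  simp only [mulVec, dotProduct, tensorP, of_apply, mul_sub, sub_mul, sum_sub_distrib,
    e1, mul_ite, ite_mul, mul_one, mul_zero, zero_mul, sum_ite_eq, mem_univ, if_true]
  ring

theorem tensorQ_mulVec (c α : Config k) (i : Fin (2 * k + 1)) :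
    (tensorQ k c).mulVec α i = c i * (c i * (c (i + 1) * α (i + 1) - c (i - 1) * α (i - 1))
      + c (i + 1) * (c (i + 1) * α (i + 1) + c (i + 2) * α (i + 2))
      - c (i - 1) * (c (i - 1) * α (i - 1) + c (i - 2) * α (i - 2))) := by
  have e1 (j : Fin (2 * k + 1)) : j + 1 = i ↔ i - 1 = j := eq_sub_one_iff i j
  simp only [mulVec, dotProduct, tensorQ, of_apply, mul_sub, sub_mul, add_mul, sum_sub_distrib,
    sum_add_distrib,
    e1, mul_ite, ite_mul, mul_one, mul_zero, zero_mul, sum_ite_eq, mem_univ, if_true]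
  ring

theorem tensorP_transpose (c : Config k) : (tensorP k c)ᵀ = -tensorP k c := by
  ext i j
  simp only [transpose_apply, Matrix.neg_apply, tensorP, of_apply]
  ring

theorem tensorQ_transpose (c : Config k) : (tensorQ k c)ᵀ = -tensorQ k c := by
  ext i j
  simp only [transpose_apply, Matrix.neg_apply, tensorQ, of_apply]
  have h1 : c j * c (j + 1) * c (j + 2) * (if j + 2 = i then (1 : ℝ) else 0) =
      c i * c (i - 1) * c (i - 2) * (if i - 2 = j then 1 else 0) := by
    simp only [← eq_sub_two_iff]
    split_ifs with h
    · subst h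
      rw [← site_add_one_add_one, add_sub_cancel_right, ← site_sub_one_sub_one,
        add_sub_cancel_right, add_sub_cancel_right]
      ring
    · simp
  have h2 : c i * c (i + 1) * c (i + 2) * (if i + 2 = j then (1 : ℝ) else 0) =
      c j * c (j - 1) * c (j - 2) * (if j - 2 = i then 1 else 0) := by
    simp only [← eq_sub_two_iff]
    split_ifs with h
    · subst h
      rw [← site_add_one_add_one, add_sub_cancel_right, ← site_sub_one_sub_one,
        add_sub_cancel_right, add_sub_cancel_right]
      ring
    · simp
  rw [h1, h2]
  ring

theorem dotProduct_mulVec_skew {ι : Type*} [Fintype ι] {A : Matrix ι ι ℝ} (hA : Aᵀ = -A)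
    (α β : ι → ℝ) : α ⬝ᵥ A *ᵥ β = -(β ⬝ᵥ A *ᵥ α) := by
  rw [dotProduct_mulVec, dotProduct_comm, ← mulVec_transpose, hA, neg_mulVec, dotProduct_neg]

theorem dotProduct_mulVec_self_skew {ι : Type*} [Fintype ι] {A : Matrix ι ι ℝ} (hA : Aᵀ = -A)
    (α : ι → ℝ) : α ⬝ᵥ A *ᵥ α = 0 := by
  have := dotProduct_mulVec_skew hA α α
  linarith

theorem wedge_mulVec {ι : Type*} [Fintype ι] (X Z : (ι → ℝ) → ι → ℝ) (c α : ι → ℝ) :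
    wedge X Z c *ᵥ α = (Z c ⬝ᵥ α) • X c - (X c ⬝ᵥ α) • Z c := by
  ext i
  simp only [mulVec, dotProduct, wedge, of_apply, sub_mul, sum_sub_distrib, Pi.sub_apply,
    Pi.smul_apply, smul_eq_mul, sum_mul]
  congr 1 <;> exact sum_congr rfl fun j _ => by ring

theorem wedge_transpose {ι : Type*} (X Z : (ι → ℝ) → ι → ℝ) (c : ι → ℝ) :
    (wedge X Z c)ᵀ = -wedge X Z c := by
  ext i j
  simp only [transpose_apply, Matrix.neg_apply, wedge, of_apply]
  ring

theorem tensorQdef_transpose (c : Config k) : (tensorQdef k c)ᵀ = -tensorQdef k c := by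
  rw [tensorQdef, transpose_sub, tensorQ_transpose, wedge_transpose]
  abel

/-- The differential of `log (c_1 ⋯ c_n)`. -/
noncomputable def logVol (k : ℕ) (c : Config k) : Config k := fun i => (c i)⁻¹

theorem tensorP_mulVec_logVol {c : Config k} (hc : c ∈ phaseSpace k) :
    tensorP k c *ᵥ logVol k c = 0 := by
  ext i
  rw [tensorP_mulVec]
  simp [logVol, (hc _).ne']

theorem grad_ham_zero {c : Config k} (hc : c ∈ phaseSpace k) :
    grad (ham k 0) c = (-(ham k 0 c / 2)) • logVol k c := by
  have hπ := rootProd_pos hc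
  have hfun : ham k 0 = fun c => 1 / rootProd k c := funext ham_zero
  have hdiff : DifferentiableAt ℝ (ham k 0) c := by
    rw [hfun]
    exact ((contDiffAt_const.div (contDiffAt_rootProd hc) hπ.ne').differentiableAt
      (n := ∞) (by simp))
  ext i
  have h := mul_grad_eq_of_expCurve (f := ham k 0) (c := c) (d := -(ham k 0 c / 2)) i hdiff (by
    have : (fun s => ham k 0 (expCurve (Pi.single i 1) c s)) =
        fun s => Real.exp (-s / 2) * ham k 0 c := by
      ext s
      have e : s * ∑ j, (Pi.single i 1 : Config k) j = s := by simp
      rw [ham_zero, ham_zero, rootProd_expCurve, e, neg_div, Real.exp_neg]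
      have := (Real.exp_pos (s / 2)).ne'
      field_simp
    rw [this]
    have h := (((hasDerivAt_neg (0 : ℝ)).div_const 2).exp).mul_const (ham k 0 c)
    refine h.congr_deriv ?_
    simp
    ring)
  have := (hc i).ne'
  rw [Pi.smul_apply, smul_eq_mul, logVol, ← h]
  field_simp

theorem fieldX_eq {c : Config k} (hc : c ∈ phaseSpace k) :
    fieldX k c = (-(ham k 0 c / 2)) • tensorQ k c *ᵥ logVol k c := by
  rw [fieldX, sharp, grad_ham_zero hc, mulVec_smul]

theorem ham_zero_pos {c : Config k} (hc : c ∈ phaseSpace k) : 0 < ham k 0 c := by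
  rw [ham_zero]
  exact one_div_pos.2 (rootProd_pos hc)

theorem dotProduct_fieldZ (c α : Config k) :
    fieldZ k c ⬝ᵥ α = -(1 / ham k 0 c) *
      (c 0 * α 0 + c (Fin.last (2 * k)) * α (Fin.last (2 * k))) := by
  rw [fieldZ, smul_dotProduct, add_dotProduct, single_dotProduct, single_dotProduct, smul_eq_mul]

/-- This is the purpose of the deformation. Since d𝓗_0 = -(𝓗_0/2) d log(c_1⋯c_n) and Z pairs with d
log(c_1⋯c_n) to -2/𝓗_0, the wedge term reproduces Q d log(c_1⋯c_n); its other half vanishes by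
skewness of Q. -/
theorem tensorQdef_mulVec_logVol {c : Config k} (hc : c ∈ phaseSpace k) :
    tensorQdef k c *ᵥ logVol k c = 0 := by
  have hH := (ham_zero_pos hc).ne'
  have h0 := (hc 0).ne'
  have hl := (hc (Fin.last (2 * k))).ne'
  rw [tensorQdef, sub_mulVec, wedge_mulVec, dotProduct_fieldZ, fieldX_eq hc, smul_dotProduct,
    dotProduct_comm (tensorQ k c *ᵥ _), dotProduct_mulVec_self_skew (tensorQ_transpose c),
    smul_zero, zero_smul, sub_zero, smul_smul]
  have : -(1 / ham k 0 c) * (c 0 * logVol k c 0 +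
      c (Fin.last (2 * k)) * logVol k c (Fin.last (2 * k))) * (-(ham k 0 c / 2)) = 1 := by
    simp only [logVol]
    field_simp
    norm_num
  rw [this, one_smul, sub_self]

/-- A covector annihilated by `Z` that satisfies the eigenvalue equation of the pencil
`Q - ν P` modulo `Z` is an eigenvector of the deformed pencil. -/
theorem tensorQdef_mulVec_eq {c : Config k} (hc : c ∈ phaseSpace k) {ν r : ℝ} {α : Config k}
    (hZ : c 0 * α 0 + c (Fin.last (2 * k)) * α (Fin.last (2 * k)) = 0)
    (h : tensorQ k c *ᵥ α = ν • tensorP k c *ᵥ α + r •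
      (Pi.single 0 (c 0) + Pi.single (Fin.last (2 * k)) (c (Fin.last (2 * k))))) :
    tensorQdef k c *ᵥ α = ν • tensorP k c *ᵥ α := by
  have h0 := (hc 0).ne'
  have hl := (hc (Fin.last (2 * k))).ne'
  obtain ⟨s, hs⟩ : ∃ s : ℝ, tensorQdef k c *ᵥ α = ν • tensorP k c *ᵥ α + s •
      (Pi.single 0 (c 0) + Pi.single (Fin.last (2 * k)) (c (Fin.last (2 * k)))) := by
    refine ⟨r + (fieldX k c ⬝ᵥ α) * -(1 / ham k 0 c), ?_⟩
    rw [tensorQdef, sub_mulVec, wedge_mulVec, dotProduct_fieldZ, hZ, mul_zero, zero_smul, zero_sub,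
      sub_neg_eq_add, h, fieldZ, smul_smul, add_smul, add_assoc]
  have h1 : logVol k c ⬝ᵥ tensorQdef k c *ᵥ α = 0 := by
    rw [dotProduct_mulVec_skew (tensorQdef_transpose c), tensorQdef_mulVec_logVol hc,
      dotProduct_zero, neg_zero]
  have h2 : logVol k c ⬝ᵥ tensorP k c *ᵥ α = 0 := by
    rw [dotProduct_mulVec_skew (tensorP_transpose c), tensorP_mulVec_logVol hc,
      dotProduct_zero, neg_zero]
  -- The form d log(c_1⋯c_n) annihilates the images of P and Q̃, but takes the value 2 on c_0∂_0 +
  -- c_l∂_l.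
  have hs0 : s = 0 := by
    rw [hs, dotProduct_add, dotProduct_smul, h2, smul_zero, zero_add, dotProduct_smul,
      dotProduct_add, dotProduct_single, dotProduct_single] at h1
    simp only [logVol, inv_mul_cancel₀ h0, inv_mul_cancel₀ hl, smul_eq_mul] at h1
    linarith
  rw [hs, hs0, zero_smul, add_zero]

theorem occ_of_mem {S : Finset (Fin (2 * k + 1))} {j : Fin (2 * k + 1)} (hj : j ∈ S)
    (y : Config k) : occ k (mask S y) j = 0 := by
  simp [occ, mask, hj]

theorem phi_eq_add_occ_zero (hk : 1 ≤ k) (ν : ℝ) (c : Config k) :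
    phi k {Fin.last (2 * k)} ν c = phi k {0, Fin.last (2 * k)} ν c +
      occ k (mask {Fin.last (2 * k)} ((-ν⁻¹) • c)) 0 := by
  have h := indepPoly_rec hk 0 (mask {Fin.last (2 * k)} ((-ν⁻¹) • c))
  rw [mask_mask] at h
  exact h

/-- The differentials at fixed `ν` of `φ_S / π` are eigenvectors of the recursion operator at the
roots `ν` of the polynomial `Δ`. -/
theorem tensorQdef_mulVec_grad_phi (hk : 1 ≤ k) {S : Finset (Fin (2 * k + 1))}
    (hS : S = {Fin.last (2 * k)} ∨ S = {0, Fin.last (2 * k)}) {ν : ℝ} (hν : ν ≠ 0)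
    {c : Config k} (hc : c ∈ phaseSpace k) (hφ : phi k {0, Fin.last (2 * k)} ν c = 0) :
    tensorQdef k c *ᵥ grad (fun c => phi k S ν c / rootProd k c) c =
      ν • tensorP k c *ᵥ grad (fun c => phi k S ν c / rootProd k c) c := by
  have hl0 := zero_ne_last hk
  have hπ := (rootProd_pos hc).ne'
  set l := Fin.last (2 * k) with hl
  set y : Config k := mask S ((-ν⁻¹) • c) with hy
  have hφS : phi k S ν c = indepPoly k y := rfl
  set g : Config k := fun i => occ k y i - indepPoly k y / 2 with hg
  have hgrad (i) : c i * grad (fun c => phi k S ν c / rootProd k c) c i = g i / rootProd k c :=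
    mul_grad_phi_div hk S hν hc i
  have hlS : l ∈ S := by rcases hS with rfl | rfl <;> simp
  have hgl : g l = -(indepPoly k y / 2) := by
    rw [hg]
    simp only [hy, occ_of_mem hlS]
    ring
  -- This uses that ν is a root of Δ: for S = {l} all of I(y) comes from sets containing 0, and for
  -- S = {0, l} one has I(y) = 0.
  have hg0 : g 0 = indepPoly k y / 2 := by
    rcases hS with rfl | rfl
    · have := phi_eq_add_occ_zero hk ν c
      rw [← hl, hφ, zero_add] at this
      simp only [hg, hy, ← this]
      change phi k {l} ν c - phi k {l} ν c / 2 = phi k {l} ν c / 2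
      ring
    · have h1 : occ k y 0 = 0 := occ_of_mem (by simp) _
      rw [hφ] at hφS
      simp only [hg, h1, ← hφS]
      ring
  have hZ : g 0 + g l = 0 := by rw [hg0, hgl]; ring
  have hyS (i) : y i = if i ∈ S then 0 else -ν⁻¹ * c i := rfl
  -- the defect between the masked and the full configuration
  set δ : Config k := fun i => if i ∈ S then c i else 0 with hδ
  have hcy (i) : c i = δ i - ν * y i := by
    simp only [hδ, hyS]
    split_ifs
    · ring
    · field_simp
      ring
  have hδ0 (i) (h0 : i ≠ 0) (hi : i ≠ l) : δ i = 0 := by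
    have : i ∉ S := by rcases hS with rfl | rfl <;> simp [h0, hi]
    simp [hδ, this]
  have key (i) : y i * (g (i + 1) - g (i - 1)) + y (i + 1) * (g (i + 1) + g (i + 2))
      - y (i - 1) * (g (i - 1) + g (i - 2)) + (g (i + 1) - g (i - 1)) = 0 := by
    have := occ_identity hk y i
    simp only [hg]
    linear_combination this
  have hl1 : l + 1 = 0 := last_add_one
  have h0m : (0 : Fin (2 * k + 1)) - 1 = l := zero_sub_one
  -- The defect at site 0. By g 0 + g l = 0 the defect at l is the same and those at the neighbours
  -- of the seam vanish, so the total defect is proportional to Z.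
  set r := δ 0 * (g 1 - g l) - δ l * (g l + g (l - 1)) with hr
  have main (i) : δ i * (g (i + 1) - g (i - 1)) + δ (i + 1) * (g (i + 1) + g (i + 2))
      - δ (i - 1) * (g (i - 1) + g (i - 2)) = if i = 0 ∨ i = l then r else 0 := by
    rw [← site_add_one_add_one, ← site_sub_one_sub_one]
    have e1 : (0 : Fin (2 * k + 1)) + 1 ≠ 0 := site_add_one_ne hk 0
    have e2 : l - 1 ≠ l := fun h => site_add_one_ne hk (l - 1) (by rw [sub_add_cancel, h])
    split_ifs with h
    · rcases h with rfl | rfl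
      · have d1 : δ (0 + 1) * (g (0 + 1) + g (0 + 1 + 1)) = 0 := by
          by_cases h : (0 : Fin (2 * k + 1)) + 1 = l
          · exact absurd (by rw [h, hl1]) (site_add_two_ne hk 0 ∘ (site_add_one_add_one 0).symm.trans)
          · rw [hδ0 _ e1 h, zero_mul]
        rw [d1, h0m, zero_add, hr]
        ring
      · have d1 : δ (l - 1) = 0 := by
          refine hδ0 _ (fun h => ?_) e2
          have h' : l = 0 + 1 := by rw [← h, sub_add_cancel]
          exact site_add_two_ne hk 0 (by rw [← site_add_one_add_one, ← h', hl1])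
        rw [d1, hl1, zero_add, hr]
        linear_combination (δ l + δ 0) * hZ
    · rw [not_or] at h
      rw [hδ0 i h.1 h.2]
      have t1 : δ (i + 1) * (g (i + 1) + g (i + 1 + 1)) = 0 := by
        by_cases h1 : i + 1 = l
        · rw [h1, hl1, add_comm (g l), hZ, mul_zero]
        · rw [hδ0 _ (fun h0 => h.2 ?_) h1, zero_mul]
          rw [← h0m, ← h0, add_sub_cancel_right]
      have t2 : δ (i - 1) * (g (i - 1) + g (i - 1 - 1)) = 0 := by
        by_cases h1 : i - 1 = 0
        · rw [h1, h0m, hZ, mul_zero]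
        · rw [hδ0 _ h1 (fun h0 => h.1 ?_), zero_mul]
          rw [← hl1, ← h0, sub_add_cancel]
      rw [t1, t2]
      ring
  refine tensorQdef_mulVec_eq hc (r := r / rootProd k c) ?_ ?_
  · rw [hgrad, hgrad, ← add_div, hZ, zero_div]
  · ext i
    rw [tensorQ_mulVec, Pi.add_apply, Pi.smul_apply, tensorP_mulVec]
    simp only [hgrad, Pi.smul_apply, Pi.add_apply, smul_eq_mul]
    have e : (Pi.single 0 (c 0) : Config k) i + (Pi.single l (c l) : Config k) i =
        if i = 0 ∨ i = l then c i else 0 := by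
      by_cases h : i = 0
      · subst h; simp [hl0]
      · by_cases h' : i = l
        · subst h'; simp [h]
        · simp [h, h']
    rw [e]
    have m := main i
    have kk := key i
    have e' : r * (if i = 0 ∨ i = l then c i else 0) = c i * (if i = 0 ∨ i = l then r else 0) := by
      split_ifs <;> ring
    rw [div_mul_eq_mul_div, e', ← m]
    have h1 := hcy i
    have h2 := hcy (i + 1)
    have h3 := hcy (i - 1)
    field_simp
    linear_combination (c i * (g (i + 1) - g (i - 1))) * h1 +
      (c i * (g (i + 1) + g (i + 2))) * h2 - (c i * (g (i - 1) + g (i - 2))) * h3 - c i * ν * kk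

end Volterra

/-! ### Path polynomials: real, simple and positive roots -/

namespace Volterra

open Polynomial

/-- The pairs `(O_r, E_r)` of monic polynomials of degree `r` attached to the paths with `2r-1` and
`2r` sites and weights `a_0, a_1, …`. -/
noncomputable def pathPoly (a : ℕ → ℝ) : ℕ → ℝ[X] × ℝ[X]
  | 0 => (1, 1)
  | r + 1 => (X * (pathPoly a r).2 - C (a (2 * r)) * (pathPoly a r).1,
      X * (pathPoly a r).2 - C (a (2 * r)) * (pathPoly a r).1
        - C (a (2 * r + 1)) * (pathPoly a r).2)

theorem pathPoly_succ_fst (a : ℕ → ℝ) (r : ℕ) : (pathPoly a (r + 1)).1 =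
    X * (pathPoly a r).2 - C (a (2 * r)) * (pathPoly a r).1 := rfl

theorem pathPoly_succ_snd (a : ℕ → ℝ) (r : ℕ) : (pathPoly a (r + 1)).2 =
    (pathPoly a (r + 1)).1 - C (a (2 * r + 1)) * (pathPoly a r).2 := rfl

/-- Independence numbers of the paths with weights `b_0, b_1, …`. -/
def pathNum (b : ℕ → ℝ) : ℕ → ℝ
  | 0 => 1
  | 1 => 1
  | m + 2 => pathNum b (m + 1) + b m * pathNum b m

/-- The index of `pathNum` is one more than the number of sites; its value at 0 only serves to start
the recursion. -/
theorem eval_pathPoly (a : ℕ → ℝ) {ν : ℝ} (hν : ν ≠ 0) (r : ℕ) :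
    (pathPoly a r).1.eval ν = ν ^ r * pathNum (fun m => -ν⁻¹ * a m) (2 * r) ∧
    (pathPoly a r).2.eval ν = ν ^ r * pathNum (fun m => -ν⁻¹ * a m) (2 * r + 1) := by
  induction r with
  | zero => simp [pathPoly, pathNum]
  | succ r ih =>
    have h1 : (pathPoly a (r + 1)).1.eval ν =
        ν ^ (r + 1) * pathNum (fun m => -ν⁻¹ * a m) (2 * (r + 1)) := by
      rw [pathPoly_succ_fst, show 2 * (r + 1) = 2 * r + 2 by ring, pathNum]
      simp only [eval_sub, eval_mul, eval_X, eval_C, ih.1, ih.2]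
      field_simp
      ring
    refine ⟨h1, ?_⟩
    rw [pathPoly_succ_snd, show 2 * (r + 1) + 1 = 2 * r + 1 + 2 by ring, pathNum]
    simp only [eval_sub, eval_mul, eval_C, h1, ih.2]
    rw [show 2 * (r + 1) = 2 * r + 1 + 1 by ring]
    field_simp
    ring

theorem pathPoly_monic (a : ℕ → ℝ) (r : ℕ) :
    ((pathPoly a r).1.Monic ∧ (pathPoly a r).1.natDegree = r) ∧
    ((pathPoly a r).2.Monic ∧ (pathPoly a r).2.natDegree = r) := by
  induction r with
  | zero => simp [pathPoly, monic_one]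
  | succ r ih =>
    obtain ⟨⟨hO, hOd⟩, hE, hEd⟩ := ih
    have hdeg {p : ℝ[X]} (hp : p.natDegree = r) (b : ℝ) : (C b * p).degree < (r + 1 : ℕ) := by
      refine lt_of_le_of_lt degree_le_natDegree ?_
      have := natDegree_C_mul_le b p
      exact_mod_cast (by omega : (C b * p).natDegree < r + 1)
    have hX : (X * (pathPoly a r).2).Monic := monic_X.mul hE
    have hXd : (X * (pathPoly a r).2).natDegree = r + 1 := by
      rw [natDegree_X_mul hE.ne_zero, hEd]
    have hsub {p q : ℝ[X]} (hp : p.Monic) (hpd : p.natDegree = r + 1)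
        (hq : q.degree < (r + 1 : ℕ)) : (p - q).Monic ∧ (p - q).natDegree = r + 1 := by
      have h : q.degree < p.degree := by rwa [degree_eq_natDegree hp.ne_zero, hpd]
      exact ⟨hp.sub_of_left h, by rw [natDegree_eq_of_degree_eq (degree_sub_eq_left_of_degree_lt h),
        hpd]⟩
    have h1 := hsub hX hXd (hdeg hOd (a (2 * r)))
    rw [← pathPoly_succ_fst] at h1
    refine ⟨h1, ?_⟩
    rw [pathPoly_succ_snd]
    exact hsub h1.1 h1.2 (hdeg hEd _)

/-- A Christoffel–Darboux argument: two steps of the recursion add a square to a positive multiple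
of the previous Wronskian. Hence the zeros of O_{r+1} are simple and are not zeros of E_r. -/
theorem wronskian_pathPoly_pos {a : ℕ → ℝ} (ha : ∀ m, 0 < a m) (r : ℕ) (x : ℝ) :
    0 < (pathPoly a (r + 1)).1.derivative.eval x * (pathPoly a r).2.eval x -
      (pathPoly a (r + 1)).1.eval x * (pathPoly a r).2.derivative.eval x := by
  have step (r : ℕ) : (pathPoly a (r + 1)).1.derivative.eval x * (pathPoly a r).2.eval x -
      (pathPoly a (r + 1)).1.eval x * (pathPoly a r).2.derivative.eval x =
      (pathPoly a r).2.eval x ^ 2 + a (2 * r) *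
      ((pathPoly a r).2.derivative.eval x * (pathPoly a r).1.eval x -
        (pathPoly a r).2.eval x * (pathPoly a r).1.derivative.eval x) := by
    simp only [pathPoly_succ_fst, derivative_sub, derivative_mul, derivative_X, derivative_C,
      eval_sub, eval_add, eval_mul, eval_X, eval_C, eval_one, eval_zero]
    ring
  induction r with
  | zero => rw [step]; simp [pathPoly]
  | succ r ih =>
    rw [step]
    refine add_pos_of_nonneg_of_pos (sq_nonneg _) (mul_pos (ha _) ?_)
    have := mul_pos (ha (2 * r + 1)) ih
    simp only [pathPoly_succ_snd, derivative_sub, derivative_mul, derivative_C,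
      eval_sub, eval_add, eval_mul, eval_C, eval_zero]
    linarith

/-- A Herglotz argument: O_{r+1}/E_r = z - a_{2r} O_r/E_r and E_{r+1}/O_{r+1} = 1 - a_{2r+1}
E_r/O_{r+1}, so the imaginary parts of O_{r+1}/E_r and E_{r+1}/O_{r+1} keep the sign of Im z.
Multiplying by conjugates avoids the quotients. -/
theorem pathPoly_aeval_ne_zero {a : ℕ → ℝ} (ha : ∀ m, 0 < a m) {z : ℂ} (hz : z.im ≠ 0) (r : ℕ) :
    aeval z (pathPoly a (r + 1)).1 ≠ 0 := by
  have hz2 : 0 < z.im ^ 2 := by positivity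
  have step (r : ℕ) (hE : aeval z (pathPoly a r).2 ≠ 0)
      (hB : 0 ≤ z.im * (aeval z (pathPoly a r).2 *
        (starRingEnd ℂ) (aeval z (pathPoly a r).1)).im) :
      0 < z.im * (aeval z (pathPoly a (r + 1)).1 *
        (starRingEnd ℂ) (aeval z (pathPoly a r).2)).im := by
    have hn : 0 < Complex.normSq (aeval z (pathPoly a r).2) := Complex.normSq_pos.2 hE
    have h1 := mul_pos hz2 hn
    have h2 := mul_nonneg (ha (2 * r)).le hB
    rw [pathPoly_succ_fst]
    simp only [map_sub, map_mul, aeval_X, aeval_C, Complex.mul_im, Complex.sub_re, Complex.sub_im,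
      Complex.mul_re, Complex.conj_re, Complex.conj_im, Complex.coe_algebraMap, Complex.ofReal_re,
      Complex.ofReal_im, Complex.normSq_apply] at h1 h2 ⊢
    linarith
  have ne_of_pos {u v : ℂ} (h : 0 < z.im * (u * (starRingEnd ℂ) v).im) : u ≠ 0 := by
    rintro rfl
    simp at h
  have main (r : ℕ) : aeval z (pathPoly a r).2 ≠ 0 ∧ 0 ≤ z.im * (aeval z (pathPoly a r).2 *
        (starRingEnd ℂ) (aeval z (pathPoly a r).1)).im := by
    induction r with
    | zero => simp [pathPoly]
    | succ r ih =>
      have h := mul_pos (ha (2 * r + 1)) (step r ih.1 ih.2)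
      have h' : 0 < z.im * (aeval z (pathPoly a (r + 1)).2 *
        (starRingEnd ℂ) (aeval z (pathPoly a (r + 1)).1)).im := by
        rw [pathPoly_succ_snd]
        simp only [map_sub, map_mul, aeval_C, Complex.mul_im, Complex.sub_re, Complex.sub_im,
          Complex.mul_re, Complex.conj_re, Complex.conj_im, Complex.coe_algebraMap,
          Complex.ofReal_re, Complex.ofReal_im] at h ⊢
        linarith
      exact ⟨ne_of_pos h', h'.le⟩
  exact ne_of_pos (step r (main r).1 (main r).2)

theorem pathPoly_eval_pos {a : ℕ → ℝ} (ha : ∀ m, 0 < a m) {x : ℝ} (hx : x ≤ 0) (r : ℕ) :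
    0 < (-1) ^ r * (pathPoly a r).1.eval x ∧ 0 < (-1) ^ r * (pathPoly a r).2.eval x := by
  induction r with
  | zero => simp [pathPoly]
  | succ r ih =>
    have h1 := mul_nonneg (neg_nonneg.2 hx) ih.2.le
    have h2 := mul_pos (ha (2 * r)) ih.1
    have h3 := mul_pos (ha (2 * r + 1)) ih.2
    have h4 : 0 < (-1) ^ (r + 1) * (pathPoly a (r + 1)).1.eval x := by
      simp only [pathPoly_succ_fst, eval_sub, eval_mul, eval_X, eval_C, pow_succ]
      linarith
    refine ⟨h4, ?_⟩
    rw [pathPoly_succ_snd, eval_sub, mul_sub, eval_mul, eval_C, pow_succ] at *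
    linarith

theorem pathPoly_eval_zero (a : ℕ → ℝ) (r : ℕ) :
    (pathPoly a r).1.eval 0 = (-1) ^ r * ∏ j ∈ Finset.range r, a (2 * j) := by
  induction r with
  | zero => simp [pathPoly]
  | succ r ih =>
    rw [pathPoly_succ_fst, Finset.prod_range_succ]
    simp only [eval_sub, eval_mul, eval_X, eval_C, ih, pow_succ]
    ring

theorem pathPoly_splits {a : ℕ → ℝ} (ha : ∀ m, 0 < a m) (r : ℕ) : (pathPoly a r).1.Splits := by
  cases r with
  | zero => exact Splits.one
  | succ r =>
    refine Splits.of_splits_map (algebraMap ℝ ℂ) (IsAlgClosed.splits _) fun z hz => ?_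
    have hz' : aeval z (pathPoly a (r + 1)).1 = 0 := by
      rw [aeval_def, ← eval_map]
      exact (mem_roots'.1 hz).2
    by_contra h
    refine pathPoly_aeval_ne_zero ha (fun him => h ⟨z.re, ?_⟩) r hz'
    exact Complex.ext (by simp) (by simp [him])

theorem pathPoly_derivative_ne_zero {a : ℕ → ℝ} (ha : ∀ m, 0 < a m) {r : ℕ} {x : ℝ}
    (hx : (pathPoly a (r + 1)).1.eval x = 0) :
    (pathPoly a (r + 1)).1.derivative.eval x ≠ 0 ∧ (pathPoly a r).2.eval x ≠ 0 := by
  have h := wronskian_pathPoly_pos ha r x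
  rw [hx, zero_mul, sub_zero] at h
  exact ⟨left_ne_zero_of_mul h.ne', right_ne_zero_of_mul h.ne'⟩

theorem nodup_roots_pathPoly {a : ℕ → ℝ} (ha : ∀ m, 0 < a m) (r : ℕ) :
    (pathPoly a r).1.roots.Nodup := by
  cases r with
  | zero => simp [pathPoly]
  | succ r =>
    rw [Multiset.nodup_iff_count_le_one]
    intro x
    rw [count_roots]
    by_contra! h
    have h0 := (pathPoly_monic a (r + 1)).1.1.ne_zero
    rw [one_lt_rootMultiplicity_iff_isRoot h0] at h
    exact (pathPoly_derivative_ne_zero ha h.1).1 h.2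

theorem exists_roots_pathPoly {a : ℕ → ℝ} (ha : ∀ m, 0 < a m) (r : ℕ) :
    ∃ x : Fin r → ℝ, StrictMono x ∧ (pathPoly a r).1 = ∏ i, (X - C (x i)) := by
  have hcard : (pathPoly a r).1.roots.toFinset.card = r := by
    rw [Multiset.toFinset_card_of_nodup (nodup_roots_pathPoly ha r),
      ← (pathPoly_splits ha r).natDegree_eq_card_roots, (pathPoly_monic a r).1.2]
  refine ⟨(pathPoly a r).1.roots.toFinset.orderEmbOfFin hcard, OrderEmbedding.strictMono _, ?_⟩
  have h := Finset.prod_map Finset.univ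
    ((pathPoly a r).1.roots.toFinset.orderEmbOfFin hcard).toEmbedding (fun y => X - C y)
  rw [Finset.map_orderEmbOfFin_univ, Finset.prod,
    Multiset.toFinset_val, (nodup_roots_pathPoly ha r).dedup] at h
  exact ((pathPoly_splits ha r).eq_prod_roots_of_monic (pathPoly_monic a r).1.1).trans h

theorem sort_roots_getD {r : ℕ} {x : Fin r → ℝ} (hx : StrictMono x) (i : Fin r) :
    ((∏ j, (X - C (x j))).roots.sort (· ≤ ·)).getD i 0 = x i := by
  have h1 : (∏ j, (X - C (x j))).roots = (List.ofFn x : Multiset ℝ) := by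
    rw [roots_prod _ _ (Finset.prod_ne_zero_iff.2 fun j _ => X_sub_C_ne_zero _)]
    simp only [roots_X_sub_C, Multiset.bind_singleton]
    rw [List.ofFn_eq_map, ← Multiset.map_coe]
    rfl
  have h2 : (∏ j, (X - C (x j))).roots.sort (· ≤ ·) = List.ofFn x := by
    refine List.Perm.eq_of_pairwise' (r := (· ≤ ·)) (Multiset.pairwise_sort _ _) ?_ ?_
    · rw [List.pairwise_ofFn]
      exact fun i j hij => (hx hij).le
    · rw [← Multiset.coe_eq_coe, Multiset.sort_eq, h1]
  rw [h2, List.getD_eq_getElem _ _ (by simp), List.getElem_ofFn]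

variable {k : ℕ}

theorem site_mk_add_one {m : ℕ} (h : m + 1 < 2 * k + 1) :
    (⟨m, by omega⟩ : Fin (2 * k + 1)) + 1 = ⟨m + 1, h⟩ := by
  apply Fin.ext
  rw [Fin.val_add, Fin.val_one', Nat.mod_eq_of_lt (a := 1) (by omega), Nat.mod_eq_of_lt h]

/-- The weights of the path of sites `2, …, n-1`, listed backwards. -/
def pathWeight (c : Config k) (m : ℕ) : ℝ := c ⟨2 * k - 1 - m, by omega⟩

/-- The complement of the last `m - 1` sites of the path `2, …, n-1`. -/
def pathCompl (k m : ℕ) : Finset (Fin (2 * k + 1)) :=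
  {i | i = Fin.last (2 * k) ∨ i.val + m ≤ 2 * k}

/-- Deletion–contraction at the first remaining site: its left neighbour is already deleted, so this
is the path recursion. -/
theorem indepPoly_pathCompl (hk : 1 ≤ k) (y : Config k) (m : ℕ) :
    m ≤ 2 * k → indepPoly k (mask (pathCompl k m) y) = pathNum (pathWeight y) m := by
  have huniv (m : ℕ) (hm : m ≤ 1) : indepPoly k (mask (pathCompl k m) y) = 1 := by
    have : mask (pathCompl k m) y = 0 := by
      ext i
      have hi : i ∈ pathCompl k m := by
        simp only [pathCompl, Finset.mem_filter, Finset.mem_univ, true_and, Fin.ext_iff,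
          Fin.val_last]
        omega
      simp [mask, hi]
    rw [this, indepPoly, Finset.sum_eq_single ∅]
    · simp
    · intro s _ hs
      obtain ⟨i, hi⟩ := Finset.nonempty_iff_ne_empty.2 hs
      exact Finset.prod_eq_zero hi rfl
    · simp
  induction m using Nat.twoStepInduction with
  | zero => exact fun _ => huniv 0 zero_le_one
  | one => exact fun _ => huniv 1 le_rfl
  | more m ih0 ih1 =>
    intro hm
    rw [pathNum, ← ih0 (by omega), ← ih1 (by omega)]
    have e1 : (⟨2 * k - 1 - m, by omega⟩ : Fin (2 * k + 1)) + 1 = ⟨2 * k - m, by omega⟩ := by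
      rw [site_mk_add_one (by omega)]
      apply Fin.ext
      simp only
      omega
    have e2 : (⟨2 * k - 1 - m, by omega⟩ : Fin (2 * k + 1)) - 1 = ⟨2 * k - 2 - m, by omega⟩ := by
      rw [sub_eq_iff_eq_add, site_mk_add_one (by omega)]
      apply Fin.ext
      simp only
      omega
    refine indepPoly_mask_rec hk (i := ⟨2 * k - 1 - m, by omega⟩) y ?_ ?_ ?_
    · simp only [pathCompl, Finset.mem_filter, Finset.mem_univ, true_and, Fin.ext_iff,
          Fin.val_last]
      omega
    · intro j
      simp only [pathCompl, Finset.mem_filter, Finset.mem_univ, true_and, Fin.ext_iff,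
          Fin.val_last]
      omega
    · intro j
      rw [e1, e2]
      simp only [pathCompl, Finset.mem_filter, Finset.mem_univ, true_and, Fin.ext_iff,
          Fin.val_last]
      omega

theorem eval_pathPoly_eq_phi (hk : 1 ≤ k) {ν : ℝ} (hν : ν ≠ 0) (c : Config k) :
    (pathPoly (pathWeight c) k).1.eval ν = ν ^ k * phi k {0, Fin.last (2 * k)} ν c := by
  have h : pathCompl k (2 * k) = {0, Fin.last (2 * k)} := by
    ext i
    simp only [pathCompl, Finset.mem_filter, Finset.mem_univ, true_and, Fin.ext_iff,
          Fin.val_last, Finset.mem_insert, Finset.mem_singleton, Fin.val_zero]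
    omega
  rw [(eval_pathPoly _ hν k).1, phi, ← h, indepPoly_pathCompl hk _ _ le_rfl]
  rfl

theorem eval_pathPoly_eq_mask {m : ℕ} (hk : k = m + 1) {ν : ℝ} (hν : ν ≠ 0) (c : Config k) :
    (pathPoly (pathWeight c) m).2.eval ν = ν ^ m *
      indepPoly k (mask {0 - 1, 0, 0 + 1} ((-ν⁻¹) • c)) := by
  have h : pathCompl k (2 * m + 1) = {0 - 1, 0, 0 + 1} := by
    have e : (0 : Fin (2 * k + 1)) + 1 = ⟨1, by omega⟩ :=
      site_mk_add_one (m := 0) (by omega)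
    rw [zero_sub_one, e]
    ext i
    simp only [pathCompl, Finset.mem_filter, Finset.mem_univ, true_and, Fin.ext_iff,
          Fin.val_last, Finset.mem_insert, Finset.mem_singleton, Fin.val_zero]
    omega
  rw [(eval_pathPoly _ hν m).2, ← h, indepPoly_pathCompl (by omega) _ _ (by omega)]
  rfl

theorem minPol_eq_pathPoly (hk : 1 ≤ k) {c : Config k} (hc : c ∈ phaseSpace k) :
    minPol k c = (pathPoly (pathWeight c) k).1 := by
  -- Both evaluations involve ν⁻¹, so they are compared for ν > 0, which suffices for polynomials.
  refine eq_of_infinite_eval_eq _ _ ((Set.Ioi_infinite (0 : ℝ)).mono fun ν hν => ?_)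
  have hν' : ν ≠ 0 := (Set.mem_Ioi.1 hν).ne'
  rw [Set.mem_ofPred_eq, eval_minPol hk hν' hc, eval_pathPoly_eq_phi hk hν']

/-- Truncated subtraction gives every index past the path the weight of site 0, so positivity holds
for all `m`. -/
theorem pathWeight_pos {c : Config k} (hc : c ∈ phaseSpace k) (m : ℕ) : 0 < pathWeight c m := hc _

theorem root_spec (hk : 1 ≤ k) {c : Config k} (hc : c ∈ phaseSpace k) :
    StrictMono (fun i => root k i c) ∧ minPol k c = ∏ i, (X - C (root k i c)) := by
  obtain ⟨x, hx, hp⟩ := exists_roots_pathPoly (pathWeight_pos hc) k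
  rw [← minPol_eq_pathPoly hk hc] at hp
  have : (fun i => root k i c) = x := by
    ext i
    rw [root, hp, sort_roots_getD hx]
  exact ⟨this ▸ hx, by rw [hp]; simp_rw [← this]⟩

theorem root_eq {c : Config k} {x : Fin k → ℝ} (hx : StrictMono x)
    (hp : minPol k c = ∏ i, (X - C (x i))) (i : Fin k) : root k i c = x i := by
  rw [root, hp, sort_roots_getD hx]

theorem eval_root (hk : 1 ≤ k) {c : Config k} (hc : c ∈ phaseSpace k) (i : Fin k) :
    (minPol k c).eval (root k i c) = 0 := by
  rw [(root_spec hk hc).2, eval_prod]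
  exact Finset.prod_eq_zero (Finset.mem_univ i) (by simp)

theorem root_pos (hk : 1 ≤ k) {c : Config k} (hc : c ∈ phaseSpace k) (i : Fin k) :
    0 < root k i c := by
  by_contra! h
  have h1 := (pathPoly_eval_pos (pathWeight_pos hc) h k).1
  rw [← minPol_eq_pathPoly hk hc, eval_root hk hc, mul_zero] at h1
  exact lt_irrefl _ h1

theorem phi_root (hk : 1 ≤ k) {c : Config k} (hc : c ∈ phaseSpace k) (i : Fin k) :
    phi k {0, Fin.last (2 * k)} (root k i c) c = 0 := by
  have hν := (root_pos hk hc i).ne'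
  have h := eval_root hk hc i
  rw [eval_minPol hk hν hc] at h
  exact (mul_eq_zero.1 h).resolve_left (pow_ne_zero _ hν)

/-- At a root only the sets containing site 0 contribute. They give y_0 times, up to a power of ν,
the value of E_{k-1}, which has no common zero with Δ = O_k. -/
theorem phi_last_root_ne_zero (hk : 1 ≤ k) {c : Config k} (hc : c ∈ phaseSpace k) (i : Fin k) :
    phi k {Fin.last (2 * k)} (root k i c) c ≠ 0 := by
  obtain ⟨m, rfl⟩ : ∃ m, k = m + 1 := ⟨k - 1, by omega⟩
  have hν := (root_pos hk hc i).ne'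
  have h := eval_root hk hc i
  rw [minPol_eq_pathPoly hk hc] at h
  have h1 := (pathPoly_derivative_ne_zero (pathWeight_pos hc) h).2
  rw [eval_pathPoly_eq_mask rfl hν] at h1
  rw [phi_eq_add_occ_zero hk, phi_root hk hc, zero_add, occ, mask_mask]
  refine mul_ne_zero ?_ ?_
  · rw [mask, if_neg (by simp [zero_ne_last hk])]
    simp [hν, (hc 0).ne']
  · have e : ({0 - 1, 0, 0 + 1} : Finset (Fin (2 * (m + 1) + 1))) ∪ {Fin.last (2 * (m + 1))} =
        {0 - 1, 0, 0 + 1} := by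
      rw [zero_sub_one]
      ext j
      simp only [Finset.mem_union, Finset.mem_insert, Finset.mem_singleton]
      tauto
    rw [e]
    exact right_ne_zero_of_mul h1

theorem derivative_root_ne_zero (hk : 1 ≤ k) {c : Config k} (hc : c ∈ phaseSpace k) (i : Fin k) :
    (minPol k c).derivative.eval (root k i c) ≠ 0 := by
  obtain ⟨m, rfl⟩ : ∃ m, k = m + 1 := ⟨k - 1, by omega⟩
  have h := eval_root hk hc i
  rw [minPol_eq_pathPoly hk hc] at h ⊢
  exact (pathPoly_derivative_ne_zero (pathWeight_pos hc) h).1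

end Volterra

/-! ### The flow of Y, smoothness of the roots, and the eigencovectors dη_i, dψ_i -/

namespace Volterra

open Matrix Topology

variable {k : ℕ}

theorem lastCoeff_eq (hk : 1 ≤ k) {c : Config k} (hc : c ∈ phaseSpace k) :
    lastCoeff k c = ∏ j ∈ Finset.range k, pathWeight c (2 * j) := by
  rw [lastCoeff, minPol_eq_pathPoly hk hc, Polynomial.coeff_zero_eq_eval_zero, pathPoly_eval_zero,
    ← mul_assoc, ← mul_pow]
  norm_num

theorem lastCoeff_pos (hk : 1 ≤ k) {c : Config k} (hc : c ∈ phaseSpace k) : 0 < lastCoeff k c := by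
  rw [lastCoeff_eq hk hc]
  exact Finset.prod_pos fun j _ => pathWeight_pos hc _

theorem eventually_mem_phaseSpace {c : Config k} (hc : c ∈ phaseSpace k) :
    ∀ᶠ c' in 𝓝 c, c' ∈ phaseSpace k :=
  isOpen_phaseSpace.mem_nhds hc

theorem contDiffAt_log_lastCoeff (hk : 1 ≤ k) {c : Config k} (hc : c ∈ phaseSpace k) :
    ContDiffAt ℝ ∞ (fun c => Real.log (lastCoeff k c)) c := by
  have h : ContDiffAt ℝ ∞ (lastCoeff k) c := by
    have h1 : ContDiff ℝ ∞ (fun c : Config k => ∏ j ∈ Finset.range k, pathWeight c (2 * j)) :=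
      contDiff_prod fun j _ => contDiff_apply ℝ ℝ _
    exact h1.contDiffAt.congr_of_eventuallyEq
      ((eventually_mem_phaseSpace hc).mono fun c' hc' => lastCoeff_eq hk hc')
  exact h.log (lastCoeff_pos hk hc).ne'

theorem sum_pathWeight_single (j : Fin (2 * k + 1)) :
    ∑ r ∈ Finset.range k, pathWeight (Pi.single j 1 : Config k) (2 * r) =
      if j.val % 2 = 1 then 1 else 0 := by
  simp only [pathWeight, Pi.single_apply, Fin.ext_iff]
  split_ifs with h
  · rw [Finset.sum_eq_single ((2 * k - 1 - j.val) / 2)]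
    · exact if_pos (by omega)
    · intro r hr hne
      have := Finset.mem_range.1 hr
      exact if_neg (by omega)
    · intro hr
      rw [Finset.mem_range] at hr
      omega
  · refine Finset.sum_eq_zero fun r hr => if_neg ?_
    have := Finset.mem_range.1 hr
    omega

theorem mul_grad_log_lastCoeff (hk : 1 ≤ k) {c : Config k} (hc : c ∈ phaseSpace k)
    (j : Fin (2 * k + 1)) :
    c j * grad (fun c => Real.log (lastCoeff k c)) c j = if j.val % 2 = 1 then 1 else 0 := by
  refine mul_grad_eq_of_expCurve j ((contDiffAt_log_lastCoeff hk hc).differentiableAt (by simp)) ?_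
  have : (fun s => Real.log (lastCoeff k (expCurve (Pi.single j 1) c s))) =
      fun s => s * (if j.val % 2 = 1 then 1 else 0) + Real.log (lastCoeff k c) := by
    ext s
    rw [lastCoeff_eq hk (expCurve_mem_phaseSpace hc _ s), lastCoeff_eq hk hc,
      ← sum_pathWeight_single, Finset.mul_sum]
    have : ∏ r ∈ Finset.range k, pathWeight (expCurve (Pi.single j 1) c s) (2 * r) =
        Real.exp (∑ r ∈ Finset.range k, s * pathWeight (Pi.single j 1 : Config k) (2 * r)) *
          ∏ r ∈ Finset.range k, pathWeight c (2 * r) := by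
      rw [Real.exp_sum, ← Finset.prod_mul_distrib]
      rfl
    rw [this, Real.log_mul (Real.exp_pos _).ne'
      (Finset.prod_pos fun j _ => pathWeight_pos hc _).ne', Real.log_exp]
  rw [this]
  simpa using ((hasDerivAt_id (0 : ℝ)).mul_const (if j.val % 2 = 1 then (1 : ℝ) else 0)).add_const
    (Real.log (lastCoeff k c))

/-- P takes the difference between the two neighbours of a site, and log p_k is the sum of log c_j
over odd labels j. The neighbours have labels of equal parity except at 0 and l. -/
theorem fieldY_eq (hk : 1 ≤ k) {c : Config k} (hc : c ∈ phaseSpace k) :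
    fieldY k c = Pi.single 0 (c 0) - Pi.single (Fin.last (2 * k)) (c (Fin.last (2 * k))) := by
  have h0l := zero_ne_last hk
  ext i
  rw [fieldY, sharp, tensorP_mulVec, mul_grad_log_lastCoeff hk hc, mul_grad_log_lastCoeff hk hc,
    Pi.sub_apply]
  by_cases hi0 : i = 0
  · subst hi0
    have e : (0 : Fin (2 * k + 1)) + 1 = ⟨1, by omega⟩ := site_mk_add_one (m := 0) (by omega)
    rw [e, zero_sub_one]
    simp [h0l]
  · by_cases hil : i = Fin.last (2 * k)
    · subst hil
      have e : Fin.last (2 * k) - 1 = ⟨2 * k - 1, by omega⟩ := by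
        rw [sub_eq_iff_eq_add, site_mk_add_one (by omega)]
        apply Fin.ext
        simp only [Fin.val_last]
        omega
      have e2 : (2 * k - 1) % 2 = 1 := by omega
      rw [e, last_add_one]
      simp [hi0, e2]
    · have hi0' : i.val ≠ 0 := fun h => hi0 (Fin.ext h)
      have hil' : i.val ≠ 2 * k := fun h => hil (Fin.ext h)
      have e1 : i + 1 = ⟨i.val + 1, by omega⟩ := site_mk_add_one (m := i.val) (by omega)
      have e2 : i - 1 = ⟨i.val - 1, by omega⟩ := by
        rw [sub_eq_iff_eq_add, site_mk_add_one (by omega)]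
        apply Fin.ext
        simp only
        omega
      have e3 : (i.val + 1) % 2 = (i.val - 1) % 2 := by omega
      rw [e1, e2]
      simp [hi0, hil, e3]

/-- The weights of the flow of `Y`. -/
def weightY (k : ℕ) : Config k := Pi.single 0 1 - Pi.single (Fin.last (2 * k)) 1

theorem fieldY_eq_weight (hk : 1 ≤ k) {c : Config k} (hc : c ∈ phaseSpace k) :
    fieldY k c = fun i => weightY k i * c i := by
  rw [fieldY_eq hk hc]
  ext i
  have h (j : Fin (2 * k + 1)) : (Pi.single j (c j) : Config k) i =
      (Pi.single j 1 : Config k) i * c i := by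
    rcases eq_or_ne i j with rfl | h
    · simp
    · simp [h]
  rw [Pi.sub_apply, h, h, weightY, Pi.sub_apply, sub_mul]

theorem lie_fieldY_eq (hk : 1 ≤ k) {c : Config k} (hc : c ∈ phaseSpace k) {f : Config k → ℝ} {d : ℝ}
    (hf : DifferentiableAt ℝ f c) (hd : HasDerivAt (fun s => f (expCurve (weightY k) c s)) d 0) :
    lie (fieldY k) f c = d := by
  rw [lie, fieldY_eq_weight hk hc]
  exact fderiv_eq_of_expCurve hf hd

theorem minPol_congr (hk : 1 ≤ k) {c c' : Config k} (hc : c ∈ phaseSpace k)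
    (hc' : c' ∈ phaseSpace k)
    (h : mask {0, Fin.last (2 * k)} c = mask {0, Fin.last (2 * k)} c') :
    minPol k c = minPol k c' := by
  simp only [minPol, lie_fieldZ_ham hk _ hc, lie_fieldZ_ham hk _ hc', h]

theorem root_expCurve (hk : 1 ≤ k) {c : Config k} (hc : c ∈ phaseSpace k) (i : Fin k) (t : ℝ) :
    root k i (expCurve (weightY k) c t) = root k i c := by
  rw [root, root, minPol_congr hk (expCurve_mem_phaseSpace hc _ t) hc]
  ext j
  simp only [mask]
  split_ifs with h
  · rfl
  · simp only [Finset.mem_insert, Finset.mem_singleton, not_or] at h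
    simp [expCurve, weightY, h.1, h.2]

theorem minPol_monic (hk : 1 ≤ k) {c : Config k} (hc : c ∈ phaseSpace k) :
    (minPol k c).Monic ∧ (minPol k c).natDegree = k := by
  rw [minPol_eq_pathPoly hk hc]
  exact (pathPoly_monic _ k).1

theorem minPol_eq_prod (hk : 1 ≤ k) {c : Config k} (hc : c ∈ phaseSpace k) {x : Fin k → ℝ}
    (hx : Function.Injective x) (h : ∀ i, (minPol k c).eval (x i) = 0) :
    minPol k c = ∏ i, (Polynomial.X - Polynomial.C (x i)) := by
  symm
  have hd : ∏ i, (Polynomial.X - Polynomial.C (x i)) ∣ minPol k c := by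
    refine Finset.prod_dvd_of_coprime ?_ fun i _ => Polynomial.dvd_iff_isRoot.2 (h i)
    exact fun i _ j _ hij => Polynomial.pairwise_coprime_X_sub_C hx hij
  refine Polynomial.eq_of_dvd_of_natDegree_le_of_leadingCoeff hd ?_ ?_
  · rw [(minPol_monic hk hc).2, Polynomial.natDegree_prod_of_monic _ _
      fun i _ => Polynomial.monic_X_sub_C _]
    simp
  · rw [(minPol_monic hk hc).1.leadingCoeff,
      (Polynomial.monic_prod_of_monic _ _ fun i _ => Polynomial.monic_X_sub_C _).leadingCoeff]

theorem hasDerivAt_phi_root (hk : 1 ≤ k) {c : Config k} (hc : c ∈ phaseSpace k) (i : Fin k) :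
    ∃ d : ℝ, d ≠ 0 ∧
      HasDerivAt (fun ν => phi k {0, Fin.last (2 * k)} ν c) d (root k i c) := by
  have hν := (root_pos hk hc i).ne'
  refine ⟨_, ?_, ((((minPol k c).hasDerivAt (root k i c)).div (hasDerivAt_pow k (root k i c))
    (pow_ne_zero k hν)).congr_of_eventuallyEq ?_)⟩
  · rw [eval_root hk hc, zero_mul, sub_zero]
    exact div_ne_zero (mul_ne_zero (derivative_root_ne_zero hk hc i) (pow_ne_zero _ hν))
      (pow_ne_zero _ (pow_ne_zero _ hν))
  · filter_upwards [eventually_ne_nhds hν] with ν hν'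
    rw [Pi.div_apply, eval_minPol hk hν' hc, mul_div_cancel_left₀ _ (pow_ne_zero k hν')]

theorem exists_contDiffAt_eq_zero {E : Type*} [NormedAddCommGroup E] [NormedSpace ℝ E]
    [CompleteSpace E] {F : ℝ × E → ℝ} {x : ℝ} {c : E} (hF : ContDiffAt ℝ ∞ F (x, c))
    (h0 : F (x, c) = 0) {d : ℝ} (hd : d ≠ 0) (hderiv : HasDerivAt (fun ν => F (ν, c)) d x) :
    ∃ ρ : E → ℝ, ρ c = x ∧ ContDiffAt ℝ ∞ ρ c ∧ ∀ᶠ c' in 𝓝 c, F (ρ c', c') = 0 := by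
  have hG : ContDiffAt ℝ ∞ (fun p : E × ℝ => F (p.2, p.1)) (c, x) :=
    ContDiffAt.comp (c, x) (g := F) (f := fun p : E × ℝ => (p.2, p.1)) hF
      (contDiffAt_snd.prodMk contDiffAt_fst)
  have hinv : (fderiv ℝ (fun p : E × ℝ => F (p.2, p.1)) (c, x) ∘L
      .inr ℝ E ℝ).IsInvertible := by
    refine ⟨ContinuousLinearEquiv.unitsEquivAut ℝ (Units.mk0 d hd), ?_⟩
    ext
    have h1 : HasDerivAt (fun ν : ℝ => (c, ν)) ((0 : E), (1 : ℝ)) x :=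
      (hasDerivAt_const x c).prodMk (hasDerivAt_id x)
    have h2 := ((hG.differentiableAt (by simp)).hasFDerivAt.comp_hasDerivAt x h1).unique hderiv
    simpa using h2.symm
  refine ⟨hG.implicitFunction (by simp) hinv, hG.implicitFunction_apply_self (by simp) hinv,
    hG.contDiffAt_implicitFunction (by simp) hinv, ?_⟩
  exact (hG.eventually_apply_implicitFunction (by simp) hinv).mono fun c' h => h.trans h0

/-- The implicit function theorem gives smooth branches through the simple roots. Nearby they stay
strictly ordered, hence are k distinct zeros of a monic polynomial of degree k, and so agree with
its sorted roots. -/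
theorem contDiffAt_root (hk : 1 ≤ k) {c : Config k} (hc : c ∈ phaseSpace k) (i : Fin k) :
    ContDiffAt ℝ ∞ (root k i) c := by
  have hex (j : Fin k) : ∃ ρ : Config k → ℝ, ρ c = root k j c ∧ ContDiffAt ℝ ∞ ρ c ∧
      ∀ᶠ c' in 𝓝 c, phi k {0, Fin.last (2 * k)} (ρ c') c' = 0 := by
    obtain ⟨d, hd, hderiv⟩ := hasDerivAt_phi_root hk hc j
    exact exists_contDiffAt_eq_zero
      (F := fun p : ℝ × Config k => phi k {0, Fin.last (2 * k)} p.1 p.2)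
      (contDiffAt_phi _ (p := (root k j c, c)) (root_pos hk hc j).ne') (phi_root hk hc j)
      hd hderiv
  choose ρ hρ0 hρ hρφ using hex
  have hmono : ∀ᶠ c' in 𝓝 c, StrictMono fun j => ρ j c' := by
    have : ∀ᶠ c' in 𝓝 c, ∀ a b : Fin k, a < b → ρ a c' < ρ b c' := by
      rw [Filter.eventually_all]
      intro a
      rw [Filter.eventually_all]
      intro b
      by_cases hab : a < b
      · have h := (hρ a).continuousAt.eventually_lt (hρ b).continuousAt
          (by rw [hρ0, hρ0]; exact (root_spec hk hc).1 hab)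
        exact h.mono fun _ h _ => h
      · exact Filter.Eventually.of_forall fun _ h => absurd h hab
    exact this
  have hne : ∀ᶠ c' in 𝓝 c, ∀ j, ρ j c' ≠ 0 := by
    rw [Filter.eventually_all]
    intro j
    exact (hρ j).continuousAt.eventually_ne (by rw [hρ0]; exact (root_pos hk hc j).ne')
  refine (hρ i).congr_of_eventuallyEq ?_
  filter_upwards [hmono, hne, Filter.eventually_all.2 hρφ, eventually_mem_phaseSpace hc]
    with c' h1 h2 h3 h4
  refine root_eq h1 (minPol_eq_prod hk h4 h1.injective fun j => ?_) i
  rw [eval_minPol hk (h2 j) h4, h3, mul_zero]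

/-- The function `ν^k φ_S / π`. For `S = ∅` it is the Casimir polynomial. -/
noncomputable def amp (k : ℕ) (S : Finset (Fin (2 * k + 1))) (p : ℝ × Config k) : ℝ :=
  p.1 ^ k * (phi k S p.1 p.2 / rootProd k p.2)

theorem contDiffAt_amp (S : Finset (Fin (2 * k + 1))) {p : ℝ × Config k} (hp : p.1 ≠ 0)
    (hc : p.2 ∈ phaseSpace k) : ContDiffAt ℝ ∞ (amp k S) p :=
  (contDiffAt_fst.pow k).mul ((contDiffAt_phi S hp).div
    ((contDiffAt_rootProd hc).comp p contDiffAt_snd) (rootProd_pos hc).ne')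

theorem contDiffAt_amp_root (hk : 1 ≤ k) (S : Finset (Fin (2 * k + 1))) {c : Config k}
    (hc : c ∈ phaseSpace k) (i : Fin k) :
    ContDiffAt ℝ ∞ (fun c => amp k S (root k i c, c)) c :=
  ContDiffAt.comp c (f := fun c => (root k i c, c))
    (contDiffAt_amp S (p := (root k i c, c)) (root_pos hk hc i).ne' hc)
    ((contDiffAt_root hk hc i).prodMk contDiffAt_id)

theorem casimirAtRoot_eq (hk : 1 ≤ k) {c : Config k} (hc : c ∈ phaseSpace k) (i : Fin k) :
    casimirAtRoot k i c = amp k ∅ (root k i c, c) := by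
  rw [casimirAtRoot, casimir_eq (root_pos hk hc i).ne', amp, phi, mask_empty, mul_div_assoc]

theorem mask_expCurve_weightY (r t : ℝ) (c : Config k) {T : Finset (Fin (2 * k + 1))}
    (h0 : 0 ∈ T) (hl : Fin.last (2 * k) ∈ T) :
    mask T (r • expCurve (weightY k) c t) = mask T (r • c) := by
  ext j
  simp only [mask]
  split_ifs with h
  · rfl
  · have h1 : j ≠ 0 := fun h' => h (h' ▸ h0)
    have h2 : j ≠ Fin.last (2 * k) := fun h' => h (h' ▸ hl)
    simp [expCurve, weightY, h1, h2]

theorem weightY_zero (hk : 1 ≤ k) : weightY k 0 = 1 := by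
  simp [weightY, zero_ne_last hk]

theorem weightY_last (hk : 1 ≤ k) : weightY k (Fin.last (2 * k)) = -1 := by
  simp [weightY, (zero_ne_last hk).symm]

theorem rootProd_expCurve_weightY (c : Config k) (t : ℝ) :
    rootProd k (expCurve (weightY k) c t) = rootProd k c := by
  have : ∑ i, weightY k i = 0 := by simp [weightY]
  rw [rootProd_expCurve, this]
  simp

theorem phi_last_expCurve (hk : 1 ≤ k) {ν : ℝ} {c : Config k}
    (h : phi k {0, Fin.last (2 * k)} ν c = 0) (t : ℝ) :
    phi k {Fin.last (2 * k)} ν (expCurve (weightY k) c t) =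
      Real.exp t * phi k {Fin.last (2 * k)} ν c := by
  rw [phi_eq_add_occ_zero hk, phi_eq_add_occ_zero hk, phi, mask_expCurve_weightY _ _ _ (by simp)
    (by simp), ← phi, h, zero_add, zero_add, occ, occ, mask_mask, mask_mask,
    mask_expCurve_weightY _ _ _
      (Finset.mem_union_left _ (Finset.mem_insert_of_mem (Finset.mem_insert_self _ _))) (by simp),
    ← mul_assoc]
  congr 1
  have e (d : Config k) : mask {Fin.last (2 * k)} d 0 = d 0 := if_neg (by simp [zero_ne_last hk])
  rw [e, e]
  simp only [Pi.smul_apply, smul_eq_mul, expCurve, weightY_zero hk, mul_one]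
  ring

/-- At a root of Δ every surviving term is linear in exactly one of c_0 and c_l, scaled by e^t and
e^{-t} respectively; the terms with c_0 make up φ_{l}. -/
theorem phi_empty_expCurve (hk : 1 ≤ k) {ν : ℝ} {c : Config k}
    (h : phi k {0, Fin.last (2 * k)} ν c = 0) (t : ℝ) :
    phi k ∅ ν (expCurve (weightY k) c t) = Real.exp t * phi k {Fin.last (2 * k)} ν c +
      Real.exp (-t) * (phi k ∅ ν c - phi k {Fin.last (2 * k)} ν c) := by
  have h1 (c : Config k) : phi k ∅ ν c = phi k {Fin.last (2 * k)} ν c +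
      occ k ((-ν⁻¹) • c) (Fin.last (2 * k)) := by
    rw [phi, mask_empty, indepPoly_rec hk (Fin.last (2 * k))]
    rfl
  rw [h1, h1, phi_last_expCurve hk h, add_sub_cancel_left, occ, occ,
    mask_expCurve_weightY _ _ _ (by simp) (by simp), ← mul_assoc]
  congr 2
  simp only [Pi.smul_apply, smul_eq_mul, expCurve, weightY_last hk, mul_neg, mul_one]
  ring

theorem amp_last_expCurve (hk : 1 ≤ k) {c : Config k} (hc : c ∈ phaseSpace k) (i : Fin k) (t : ℝ) :
    amp k {Fin.last (2 * k)} (root k i (expCurve (weightY k) c t), expCurve (weightY k) c t) =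
      Real.exp t * amp k {Fin.last (2 * k)} (root k i c, c) := by
  simp only [amp, root_expCurve hk hc, phi_last_expCurve hk (phi_root hk hc i),
    rootProd_expCurve_weightY]
  ring

theorem amp_empty_expCurve (hk : 1 ≤ k) {c : Config k} (hc : c ∈ phaseSpace k) (i : Fin k) (t : ℝ) :
    amp k ∅ (root k i (expCurve (weightY k) c t), expCurve (weightY k) c t) =
      Real.exp t * amp k {Fin.last (2 * k)} (root k i c, c) +
      Real.exp (-t) * (amp k ∅ (root k i c, c) - amp k {Fin.last (2 * k)} (root k i c, c)) := by
  simp only [amp, root_expCurve hk hc, phi_empty_expCurve hk (phi_root hk hc i),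
    rootProd_expCurve_weightY]
  ring

theorem hasDerivAt_exp_zero (a b : ℝ) :
    HasDerivAt (fun s => Real.exp s * a + Real.exp (-s) * b) (a - b) 0 := by
  have h := ((Real.hasDerivAt_exp 0).mul_const a).add
    (((hasDerivAt_neg (0 : ℝ)).exp).mul_const b)
  refine h.congr_deriv ?_
  simp
  ring

theorem lie_fieldY_amp_last (hk : 1 ≤ k) {c : Config k} (hc : c ∈ phaseSpace k) (i : Fin k) :
    lie (fieldY k) (fun c => amp k {Fin.last (2 * k)} (root k i c, c)) c =
      amp k {Fin.last (2 * k)} (root k i c, c) := by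
  refine lie_fieldY_eq hk hc ((contDiffAt_amp_root hk _ hc i).differentiableAt (by simp)) ?_
  simp only [amp_last_expCurve hk hc]
  simpa using (Real.hasDerivAt_exp 0).mul_const (amp k {Fin.last (2 * k)} (root k i c, c))

theorem lie_congr {ι : Type*} [Fintype ι] {X : (ι → ℝ) → ι → ℝ} {f g : (ι → ℝ) → ℝ} {c : ι → ℝ}
    (h : f =ᶠ[𝓝 c] g) : lie X f c = lie X g c := by
  rw [lie, lie, h.fderiv_eq]

theorem lie_fieldY_casimirAtRoot (hk : 1 ≤ k) {c : Config k} (hc : c ∈ phaseSpace k) (i : Fin k) :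
    lie (fieldY k) (casimirAtRoot k i) c =
      2 * amp k {Fin.last (2 * k)} (root k i c, c) - amp k ∅ (root k i c, c) := by
  rw [lie_congr ((eventually_mem_phaseSpace hc).mono fun c' hc' => casimirAtRoot_eq hk hc' i)]
  refine lie_fieldY_eq hk hc ((contDiffAt_amp_root hk _ hc i).differentiableAt (by simp)) ?_
  simp only [amp_empty_expCurve hk hc]
  refine (hasDerivAt_exp_zero _ _).congr_deriv ?_
  ring

/-- If f becomes e^t A + e^{-t} B along the flow, then Y(f) = A - B and Y²(f) = A + B. The
combination in ψ_i isolates the component of weight one. -/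
theorem psiArg_eq (hk : 1 ≤ k) {c : Config k} (hc : c ∈ phaseSpace k) (i : Fin k) :
    psiArg k i c = 2 * amp k {Fin.last (2 * k)} (root k i c, c) := by
  have h : lie (fieldY k) (lie (fieldY k) (casimirAtRoot k i)) c = amp k ∅ (root k i c, c) := by
    rw [lie_congr ((eventually_mem_phaseSpace hc).mono
      fun c' hc' => lie_fieldY_casimirAtRoot hk hc' i)]
    have hA := (contDiffAt_amp_root hk {Fin.last (2 * k)} hc i).differentiableAt (by simp)
    have hf := (contDiffAt_amp_root hk ∅ hc i).differentiableAt (by simp)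
    refine lie_fieldY_eq hk hc ((hA.const_mul 2).sub hf) ?_
    simp only [amp_empty_expCurve hk hc, amp_last_expCurve hk hc]
    have h1 := ((Real.hasDerivAt_exp 0).mul_const
      (amp k {Fin.last (2 * k)} (root k i c, c))).const_mul 2
    refine (h1.sub (hasDerivAt_exp_zero _ _)).congr_deriv ?_
    simp
    ring
  rw [psiArg, h, lie_fieldY_casimirAtRoot hk hc]
  ring

theorem amp_last_ne_zero (hk : 1 ≤ k) {c : Config k} (hc : c ∈ phaseSpace k) (i : Fin k) :
    amp k {Fin.last (2 * k)} (root k i c, c) ≠ 0 :=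
  mul_ne_zero (pow_ne_zero _ (root_pos hk hc i).ne')
    (div_ne_zero (phi_last_root_ne_zero hk hc i) (rootProd_pos hc).ne')

theorem psiArg_ne_zero (hk : 1 ≤ k) {c : Config k} (hc : c ∈ phaseSpace k) (i : Fin k) :
    psiArg k i c ≠ 0 := by
  rw [psiArg_eq hk hc]
  exact mul_ne_zero two_ne_zero (amp_last_ne_zero hk hc i)

theorem contDiffAt_eta (hk : 1 ≤ k) {c : Config k} (hc : c ∈ phaseSpace k) (i : Fin k) :
    ContDiffAt ℝ ∞ (eta k i) c :=
  (contDiffAt_root hk hc i).log (root_pos hk hc i).ne'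

theorem psi_eventuallyEq (hk : 1 ≤ k) {c : Config k} (hc : c ∈ phaseSpace k) (i : Fin k) :
    psi k i =ᶠ[𝓝 c] fun c => Real.log (2 * amp k {Fin.last (2 * k)} (root k i c, c)) :=
  (eventually_mem_phaseSpace hc).mono fun c' hc' => by
    simp only [psi, psiArg_eq hk hc', Real.log_abs]

theorem contDiffAt_psi (hk : 1 ≤ k) {c : Config k} (hc : c ∈ phaseSpace k) (i : Fin k) :
    ContDiffAt ℝ ∞ (psi k i) c :=
  ((contDiffAt_const.mul (contDiffAt_amp_root hk _ hc i)).log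
    (mul_ne_zero two_ne_zero (amp_last_ne_zero hk hc i))).congr_of_eventuallyEq
    (psi_eventuallyEq hk hc i)

section Grad

variable {ι : Type*} [DecidableEq ι]

theorem grad_congr {f g : (ι → ℝ) → ℝ} {c : ι → ℝ} (h : f =ᶠ[𝓝 c] g) : grad f c = grad g c := by
  ext i
  rw [grad, grad, h.fderiv_eq]

variable [Fintype ι]

theorem grad_log {f : (ι → ℝ) → ℝ} {c : ι → ℝ} (hf : DifferentiableAt ℝ f c) (h0 : f c ≠ 0) :
    grad (fun c => Real.log (f c)) c = (f c)⁻¹ • grad f c := by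
  ext i
  rw [grad, fderiv.log hf h0]
  rfl

theorem grad_const_mul {f : (ι → ℝ) → ℝ} {c : ι → ℝ} (hf : DifferentiableAt ℝ f c) (a : ℝ) :
    grad (fun c => a * f c) c = a • grad f c := by
  ext i
  rw [grad, fderiv_const_mul hf]
  rfl

theorem grad_comp_pair {F : ℝ × (ι → ℝ) → ℝ} {ρ : (ι → ℝ) → ℝ} {c : ι → ℝ}
    (hF : DifferentiableAt ℝ F (ρ c, c)) (hρ : DifferentiableAt ℝ ρ c) :
    grad (fun c => F (ρ c, c)) c =
      deriv (fun ν => F (ν, c)) (ρ c) • grad ρ c + grad (fun c' => F (ρ c, c')) c := by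
  ext i
  have h1 := (HasFDerivAt.comp (f := fun c => (ρ c, c)) c hF.hasFDerivAt (hρ.hasFDerivAt.prodMk (hasFDerivAt_id c))).fderiv
  have h2 : deriv (fun ν => F (ν, c)) (ρ c) = fderiv ℝ F (ρ c, c) (1, 0) :=
    (hF.hasFDerivAt.comp_hasDerivAt (ρ c)
      ((hasDerivAt_id (ρ c)).prodMk (hasDerivAt_const (ρ c) c))).deriv
  have h3 := (HasFDerivAt.comp (f := fun c' => (ρ c, c')) c hF.hasFDerivAt
    ((hasFDerivAt_const (ρ c) c).prodMk (hasFDerivAt_id c))).fderiv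
  have e1 : fderiv ℝ (fun c => F (ρ c, c)) c = _ := h1
  have e3 : fderiv ℝ (fun c' => F (ρ c, c')) c = _ := h3
  rw [Pi.add_apply, Pi.smul_apply, grad, grad, grad, e1, e3, h2]
  simp only [ContinuousLinearMap.comp_apply, ContinuousLinearMap.prod_apply,
    _root_.zero_apply, ContinuousLinearMap.id_apply, smul_eq_mul]
  rw [mul_comm, ← smul_eq_mul, ← map_smul, ← map_add]
  simp

end Grad

/-- The covector `α` is an eigenvector with eigenvalue `ν` of the pencil of `Q - X ∧ Z` and `P`. -/
def IsEigenform (ν : ℝ) (c α : Config k) : Prop :=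
  tensorQdef k c *ᵥ α = ν • tensorP k c *ᵥ α

theorem IsEigenform.smul {ν : ℝ} {c α : Config k} (h : IsEigenform ν c α) (a : ℝ) :
    IsEigenform ν c (a • α) := by
  rw [IsEigenform] at *
  rw [mulVec_smul, mulVec_smul, h, smul_comm]

theorem IsEigenform.add {ν : ℝ} {c α β : Config k} (h : IsEigenform ν c α)
    (h' : IsEigenform ν c β) : IsEigenform ν c (α + β) := by
  rw [IsEigenform] at *
  rw [mulVec_add, mulVec_add, h, h', smul_add]

theorem isEigenform_amp (hk : 1 ≤ k) {S : Finset (Fin (2 * k + 1))}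
    (hS : S = {Fin.last (2 * k)} ∨ S = {0, Fin.last (2 * k)})
    {c : Config k} (hc : c ∈ phaseSpace k) (i : Fin k) :
    IsEigenform (root k i c) c (grad (fun c' => amp k S (root k i c, c')) c) := by
  have hν := (root_pos hk hc i).ne'
  have h := tensorQdef_mulVec_grad_phi hk hS hν hc (phi_root hk hc i)
  have hdiff : DifferentiableAt ℝ (fun c' => phi k S (root k i c) c' / rootProd k c') c := by
    refine ContDiffAt.differentiableAt (n := ∞) ?_ (by simp)
    refine ContDiffAt.div ?_ (contDiffAt_rootProd hc) (rootProd_pos hc).ne'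
    exact (contDiffAt_phi S (p := (root k i c, c)) hν).comp c
      (contDiffAt_const.prodMk contDiffAt_id)
  have e := grad_const_mul hdiff (root k i c ^ k)
  rw [show (fun c' => amp k S (root k i c, c')) = fun c' => root k i c ^ k *
    (phi k S (root k i c) c' / rootProd k c') from rfl, e]
  exact IsEigenform.smul h _

theorem deriv_amp_ne_zero (hk : 1 ≤ k) {c : Config k} (hc : c ∈ phaseSpace k) (i : Fin k) :
    deriv (fun ν => amp k {0, Fin.last (2 * k)} (ν, c)) (root k i c) ≠ 0 := by
  obtain ⟨d, hd, h⟩ := hasDerivAt_phi_root hk hc i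
  have h1 := (hasDerivAt_pow k (root k i c)).mul (h.div_const (rootProd k c))
  have h2 : HasDerivAt (fun ν => amp k {0, Fin.last (2 * k)} (ν, c)) _ (root k i c) := h1
  rw [h2.deriv, phi_root hk hc, zero_div, mul_zero, zero_add]
  exact mul_ne_zero (pow_ne_zero _ (root_pos hk hc i).ne') (div_ne_zero hd (rootProd_pos hc).ne')

/-- Differentiating φ_{0,l}(ν_i(c), c) = 0 makes dν_i a multiple of the differential at fixed ν;
simplicity of the root permits the division. -/
theorem isEigenform_root (hk : 1 ≤ k) {c : Config k} (hc : c ∈ phaseSpace k) (i : Fin k) :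
    IsEigenform (root k i c) c (grad (root k i) c) := by
  have hν := (root_pos hk hc i).ne'
  have h := grad_comp_pair
    ((contDiffAt_amp {0, Fin.last (2 * k)} (p := (root k i c, c)) hν hc).differentiableAt
      (by simp)) ((contDiffAt_root hk hc i).differentiableAt (by simp))
  have h0 : grad (fun c => amp k {0, Fin.last (2 * k)} (root k i c, c)) c = 0 := by
    rw [grad_congr (g := fun _ => 0)
      ((eventually_mem_phaseSpace hc).mono fun c' hc' => by simp [amp, phi_root hk hc'])]
    ext j
    simp [grad]
  rw [h0] at h
  set a := deriv (fun ν => amp k {0, Fin.last (2 * k)} (ν, c)) (root k i c) with ha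
  have ha0 : a ≠ 0 := deriv_amp_ne_zero hk hc i
  have e : grad (root k i) c =
      (-a⁻¹) • grad (fun c' => amp k {0, Fin.last (2 * k)} (root k i c, c')) c := by
    rw [eq_neg_of_add_eq_zero_right h.symm, smul_neg, neg_smul, neg_neg, smul_smul,
      inv_mul_cancel₀ ha0, one_smul]
  rw [e]
  exact (isEigenform_amp hk (Or.inr rfl) hc i).smul _

theorem grad_eta (hk : 1 ≤ k) {c : Config k} (hc : c ∈ phaseSpace k) (i : Fin k) :
    grad (eta k i) c = (root k i c)⁻¹ • grad (root k i) c :=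
  grad_log ((contDiffAt_root hk hc i).differentiableAt (by simp)) (root_pos hk hc i).ne'

theorem isEigenform_eta (hk : 1 ≤ k) {c : Config k} (hc : c ∈ phaseSpace k) (i : Fin k) :
    IsEigenform (root k i c) c (grad (eta k i) c) := by
  rw [grad_eta hk hc]
  exact (isEigenform_root hk hc i).smul _

/-- By the chain rule dψ_i combines dν_i with the differential at fixed ν of the amplitude for S =
{l}; both have eigenvalue ν_i. -/
theorem isEigenform_psi (hk : 1 ≤ k) {c : Config k} (hc : c ∈ phaseSpace k) (i : Fin k) :
    IsEigenform (root k i c) c (grad (psi k i) c) := by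
  have hν := (root_pos hk hc i).ne'
  have hA := (contDiffAt_amp_root hk {Fin.last (2 * k)} hc i).differentiableAt (by simp)
  have h := grad_comp_pair
    ((contDiffAt_amp {Fin.last (2 * k)} (p := (root k i c, c)) hν hc).differentiableAt
      (by simp)) ((contDiffAt_root hk hc i).differentiableAt (by simp))
  rw [grad_congr (psi_eventuallyEq hk hc i), grad_log (hA.const_mul 2)
    (mul_ne_zero two_ne_zero (amp_last_ne_zero hk hc i)), grad_const_mul hA, h]
  exact ((((isEigenform_root hk hc i).smul _).add
    (isEigenform_amp hk (Or.inl rfl) hc i)).smul _).smul _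

theorem lie_fieldY_psi (hk : 1 ≤ k) {c : Config k} (hc : c ∈ phaseSpace k) (i : Fin k) :
    grad (psi k i) c ⬝ᵥ fieldY k c = 1 := by
  have hA := (contDiffAt_amp_root hk {Fin.last (2 * k)} hc i).differentiableAt (by simp)
  have h0 := amp_last_ne_zero hk hc i
  rw [grad_congr (psi_eventuallyEq hk hc i), grad_log (hA.const_mul 2)
    (mul_ne_zero two_ne_zero h0), grad_const_mul hA, smul_dotProduct, smul_dotProduct,
    ← fderiv_eq_dotProduct_grad]
  have := lie_fieldY_amp_last hk hc i
  rw [lie] at this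
  rw [this, smul_eq_mul, smul_eq_mul]
  exact inv_mul_cancel₀ (mul_ne_zero two_ne_zero h0)

end Volterra

/-! ### Canonical brackets, the recursion operator, leaves and charts -/

namespace Volterra

open Matrix Topology

variable {k : ℕ}

theorem IsEigenform.dotProduct_eq {ν : ℝ} {c α : Config k} (h : IsEigenform ν c α)
    (β : Config k) : α ⬝ᵥ tensorQdef k c *ᵥ β = ν * (α ⬝ᵥ tensorP k c *ᵥ β) := by
  rw [IsEigenform] at h
  rw [dotProduct_mulVec_skew (tensorQdef_transpose c), h, dotProduct_smul,
    dotProduct_mulVec_skew (tensorP_transpose c) α, smul_eq_mul, mul_neg]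

theorem IsEigenform.dotProduct_eq_zero {ν μ : ℝ} {c α β : Config k} (h : IsEigenform ν c α)
    (h' : IsEigenform μ c β) (hne : ν ≠ μ) : α ⬝ᵥ tensorP k c *ᵥ β = 0 := by
  have h1 := h.dotProduct_eq β
  rw [IsEigenform] at h'
  rw [h', dotProduct_smul, smul_eq_mul] at h1
  have : (ν - μ) * (α ⬝ᵥ tensorP k c *ᵥ β) = 0 := by linarith
  exact (mul_eq_zero.1 this).resolve_left (sub_ne_zero.2 hne)

theorem root_ne (hk : 1 ≤ k) {c : Config k} (hc : c ∈ phaseSpace k) {i j : Fin k} (h : i ≠ j) :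
    root k i c ≠ root k j c :=
  (root_spec hk hc).1.injective.ne h

theorem dotProduct_grad_eta_eta (hk : 1 ≤ k) {c : Config k} (hc : c ∈ phaseSpace k)
    (i j : Fin k) : grad (eta k i) c ⬝ᵥ tensorP k c *ᵥ grad (eta k j) c = 0 := by
  rcases eq_or_ne i j with rfl | h
  · exact dotProduct_mulVec_self_skew (tensorP_transpose c) _
  · exact (isEigenform_eta hk hc i).dotProduct_eq_zero (isEigenform_eta hk hc j) (root_ne hk hc h)

theorem dotProduct_grad_psi_psi (hk : 1 ≤ k) {c : Config k} (hc : c ∈ phaseSpace k)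
    (i j : Fin k) : grad (psi k i) c ⬝ᵥ tensorP k c *ᵥ grad (psi k j) c = 0 := by
  rcases eq_or_ne i j with rfl | h
  · exact dotProduct_mulVec_self_skew (tensorP_transpose c) _
  · exact (isEigenform_psi hk hc i).dotProduct_eq_zero (isEigenform_psi hk hc j) (root_ne hk hc h)

theorem lastCoeff_eq_prod_root (hk : 1 ≤ k) {c : Config k} (hc : c ∈ phaseSpace k) :
    lastCoeff k c = ∏ i, root k i c := by
  rw [lastCoeff, Polynomial.coeff_zero_eq_eval_zero, (root_spec hk hc).2, Polynomial.eval_prod]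
  simp only [Polynomial.eval_sub, Polynomial.eval_X, Polynomial.eval_C, zero_sub,
    Finset.prod_neg, Finset.card_univ, Fintype.card_fin]
  rw [← mul_assoc, ← mul_pow]
  norm_num

theorem grad_log_lastCoeff (hk : 1 ≤ k) {c : Config k} (hc : c ∈ phaseSpace k) :
    grad (fun c => Real.log (lastCoeff k c)) c = ∑ j, grad (eta k j) c := by
  rw [grad_congr (g := fun c => ∑ j, eta k j c)]
  · ext i
    rw [grad, fderiv_fun_sum fun j _ => (contDiffAt_eta hk hc j).differentiableAt (by simp),
      _root_.sum_apply, Finset.sum_apply]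
    rfl
  · filter_upwards [eventually_mem_phaseSpace hc] with c' hc'
    rw [lastCoeff_eq_prod_root hk hc', Real.log_prod fun j _ => (root_pos hk hc' j).ne']
    rfl

/-- Off the diagonal the eigenvalues differ. On it, Y = Σ_j P dη_j, so Y(ψ_i) = 1 leaves only the
term j = i. -/
theorem dotProduct_grad_psi_eta (hk : 1 ≤ k) {c : Config k} (hc : c ∈ phaseSpace k)
    (i j : Fin k) :
    grad (psi k i) c ⬝ᵥ tensorP k c *ᵥ grad (eta k j) c = if i = j then 1 else 0 := by
  have hne {i j : Fin k} (h : i ≠ j) :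
      grad (psi k i) c ⬝ᵥ tensorP k c *ᵥ grad (eta k j) c = 0 :=
    (isEigenform_psi hk hc i).dotProduct_eq_zero (isEigenform_eta hk hc j) (root_ne hk hc h)
  split_ifs with h
  · subst h
    have h1 := lie_fieldY_psi hk hc i
    rwa [fieldY, sharp, grad_log_lastCoeff hk hc, mulVec_sum, dotProduct_sum,
      Finset.sum_eq_single i (fun j _ hj => hne hj.symm) (by simp)] at h1
  · exact hne h

theorem dotProduct_grad_eta_psi (hk : 1 ≤ k) {c : Config k} (hc : c ∈ phaseSpace k)
    (i j : Fin k) :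
    grad (eta k i) c ⬝ᵥ tensorP k c *ᵥ grad (psi k j) c = if i = j then -1 else 0 := by
  rw [dotProduct_mulVec_skew (tensorP_transpose c), dotProduct_grad_psi_eta hk hc]
  simp only [eq_comm (a := j)]
  split_ifs <;> simp

/-- The Hamiltonian vector fields realize all values of the differentials of `η` and `ψ`. -/
theorem exists_covector (hk : 1 ≤ k) {c : Config k} (hc : c ∈ phaseSpace k) (a b : Fin k → ℝ) :
    ∃ α : Config k, (∀ i, grad (eta k i) c ⬝ᵥ tensorP k c *ᵥ α = a i) ∧
      ∀ i, grad (psi k i) c ⬝ᵥ tensorP k c *ᵥ α = b i := by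
  refine ⟨∑ j, b j • grad (eta k j) c - ∑ j, a j • grad (psi k j) c, fun i => ?_, fun i => ?_⟩
  · simp [mulVec_sub, mulVec_sum, mulVec_smul, dotProduct_sub, dotProduct_sum,
      dotProduct_grad_eta_eta hk hc, dotProduct_grad_eta_psi hk hc]
  · simp [mulVec_sub, mulVec_sum, mulVec_smul, dotProduct_sub, dotProduct_sum,
      dotProduct_grad_psi_psi hk hc, dotProduct_grad_psi_eta hk hc]

theorem fderiv_prod_univ {c : Config k} (hc : c ∈ phaseSpace k) (v : Config k) :
    fderiv ℝ (fun c : Config k => ∏ i, c i) c v = (∏ i, c i) * (logVol k c ⬝ᵥ v) := by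
  have hv : v = fun i => (v i / c i) * c i := by
    ext i
    rw [div_mul_cancel₀ _ (hc i).ne']
  conv_lhs => rw [hv]
  refine fderiv_eq_of_expCurve (contDiff_prod_univ.differentiable (by simp) c) ?_
  simp only [prod_expCurve]
  have h := (((hasDerivAt_id (0 : ℝ)).mul_const (∑ i, v i / c i)).exp).mul_const (∏ i, c i)
  refine h.congr_deriv ?_
  have : logVol k c ⬝ᵥ v = ∑ i, v i / c i :=
    Finset.sum_congr rfl fun i _ => by rw [logVol, div_eq_inv_mul]
  simp [this, mul_comm]

theorem logVol_dotProduct_self {c : Config k} (hc : c ∈ phaseSpace k) :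
    logVol k c ⬝ᵥ c = 2 * k + 1 := by
  simp [dotProduct, logVol, (hc _).ne']

theorem logVol_dotProduct_tensorP {c : Config k} (hc : c ∈ phaseSpace k) (α : Config k) :
    logVol k c ⬝ᵥ tensorP k c *ᵥ α = 0 := by
  rw [dotProduct_mulVec_skew (tensorP_transpose c), tensorP_mulVec_logVol hc,
    dotProduct_zero, neg_zero]

theorem logVol_dotProduct_tensorQdef {c : Config k} (hc : c ∈ phaseSpace k) (α : Config k) :
    logVol k c ⬝ᵥ tensorQdef k c *ᵥ α = 0 := by
  rw [dotProduct_mulVec_skew (tensorQdef_transpose c), tensorQdef_mulVec_logVol hc,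
    dotProduct_zero, neg_zero]

/-- The functions `η_i`, `ψ_i` and `c_1 ⋯ c_n`, as a map to the product space. -/
noncomputable def coordMap (k : ℕ) (c : Config k) : ((Fin k → ℝ) × (Fin k → ℝ)) × ℝ :=
  ((fun i => eta k i c, fun i => psi k i c), ∏ i, c i)

theorem contDiffAt_coordMap (hk : 1 ≤ k) {c : Config k} (hc : c ∈ phaseSpace k) :
    ContDiffAt ℝ ∞ (coordMap k) c :=
  ((contDiffAt_pi.2 fun i => contDiffAt_eta hk hc i).prodMk
    (contDiffAt_pi.2 fun i => contDiffAt_psi hk hc i)).prodMk contDiff_prod_univ.contDiffAt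

theorem fderiv_coordMap (hk : 1 ≤ k) {c : Config k} (hc : c ∈ phaseSpace k) (v : Config k) :
    fderiv ℝ (coordMap k) c v = ((fun i => grad (eta k i) c ⬝ᵥ v, fun i => grad (psi k i) c ⬝ᵥ v),
      (∏ i, c i) * (logVol k c ⬝ᵥ v)) := by
  have h1 := hasFDerivAt_pi.2 fun i =>
    ((contDiffAt_eta hk hc i).differentiableAt (by simp)).hasFDerivAt
  have h2 := hasFDerivAt_pi.2 fun i =>
    ((contDiffAt_psi hk hc i).differentiableAt (by simp)).hasFDerivAt
  have h3 := (contDiff_prod_univ.differentiable (by simp) c :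
    DifferentiableAt ℝ (fun c : Config k => ∏ i, c i) c).hasFDerivAt
  have h : HasFDerivAt (coordMap k) _ c := (h1.prodMk h2).prodMk h3
  rw [h.fderiv, ← fderiv_prod_univ hc v]
  simp only [← fderiv_eq_dotProduct_grad]
  rfl

/-- Hamiltonian fields attain all values of dη and dψ without changing c_1⋯c_n, and the Euler field
supplies the remaining direction; the dimensions agree. -/
theorem bijective_fderiv_coordMap (hk : 1 ≤ k) {c : Config k} (hc : c ∈ phaseSpace k) :
    Function.Bijective (fderiv ℝ (coordMap k) c) := by
  have hsurj : Function.Surjective (fderiv ℝ (coordMap k) c) := by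
    rintro ⟨⟨a, b⟩, t⟩
    have hp : ∏ i, c i ≠ 0 := (Finset.prod_pos fun i _ => hc i).ne'
    have hn : (2 * k + 1 : ℝ) ≠ 0 := by positivity
    set s : ℝ := t / ((2 * k + 1) * ∏ i, c i) with hs
    obtain ⟨α, h1, h2⟩ := exists_covector hk hc
      (fun i => a i - grad (eta k i) c ⬝ᵥ (s • c)) (fun i => b i - grad (psi k i) c ⬝ᵥ (s • c))
    refine ⟨s • c + tensorP k c *ᵥ α, ?_⟩
    rw [fderiv_coordMap hk hc]
    simp only [dotProduct_add, h1, h2, logVol_dotProduct_tensorP hc]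
    rw [dotProduct_smul s (logVol k c) c, logVol_dotProduct_self hc]
    simp only [add_sub_cancel, add_zero, smul_eq_mul, hs]
    congr 1
    field_simp
  refine ⟨?_, hsurj⟩
  have hdim : Module.finrank ℝ (Config k) =
      Module.finrank ℝ (((Fin k → ℝ) × (Fin k → ℝ)) × ℝ) := by
    simp only [Module.finrank_prod, Module.finrank_fin_fun, Module.finrank_self]
    ring
  exact (LinearMap.injective_iff_surjective_of_finrank_eq_finrank
    (f := (fderiv ℝ (coordMap k) c : Config k →ₗ[ℝ] _)) hdim).2 hsurj

theorem exists_hasFDerivAt_coordMap (hk : 1 ≤ k) {c : Config k} (hc : c ∈ phaseSpace k) :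
    ∃ L : Config k ≃L[ℝ] ((Fin k → ℝ) × (Fin k → ℝ)) × ℝ,
      HasFDerivAt (coordMap k) (L : Config k →L[ℝ] ((Fin k → ℝ) × (Fin k → ℝ)) × ℝ) c := by
  refine ⟨(LinearEquiv.ofBijective (fderiv ℝ (coordMap k) c : Config k →ₗ[ℝ] _)
    (bijective_fderiv_coordMap hk hc)).toContinuousLinearEquiv, ?_⟩
  exact ((contDiffAt_coordMap hk hc).differentiableAt (by simp)).hasFDerivAt.congr_fderiv
    (ContinuousLinearMap.ext fun _ => rfl)

theorem mem_charSpace_iff (hk : 1 ≤ k) {c : Config k} (hc : c ∈ phaseSpace k) (v : Config k) :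
    v ∈ charSpace (tensorP k) c ↔ logVol k c ⬝ᵥ v = 0 := by
  constructor
  · rintro ⟨α, rfl⟩
    exact logVol_dotProduct_tensorP hc α
  · intro hv
    obtain ⟨α, h1, h2⟩ := exists_covector hk hc (fun i => grad (eta k i) c ⬝ᵥ v)
      (fun i => grad (psi k i) c ⬝ᵥ v)
    refine ⟨α, (bijective_fderiv_coordMap hk hc).1 ?_⟩
    rw [fderiv_coordMap hk hc, fderiv_coordMap hk hc, hv]
    simp only [mulVecLin_apply, h1, h2, logVol_dotProduct_tensorP hc]

/-- The kernel of P is spanned by d log(c_1⋯c_n), which Q̃ annihilates. This makes Q̃ ∘ P⁻¹ well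
defined on the leaf. -/
theorem tensorQdef_mulVec_eq_zero (hk : 1 ≤ k) {c : Config k} (hc : c ∈ phaseSpace k)
    {α : Config k} (hα : tensorP k c *ᵥ α = 0) : tensorQdef k c *ᵥ α = 0 := by
  have hn : (2 * k + 1 : ℝ) ≠ 0 := by positivity
  have h (v : Config k) : α ⬝ᵥ v = (((α ⬝ᵥ c) / (2 * k + 1)) • logVol k c) ⬝ᵥ v := by
    have hv : v - ((logVol k c ⬝ᵥ v) / (2 * k + 1)) • c ∈ charSpace (tensorP k) c := by
      rw [mem_charSpace_iff hk hc, dotProduct_sub, dotProduct_smul, logVol_dotProduct_self hc,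
        smul_eq_mul, div_mul_cancel₀ _ hn, sub_self]
    obtain ⟨β, hβ⟩ := hv
    have h0 : α ⬝ᵥ tensorP k c *ᵥ β = 0 := by
      rw [dotProduct_mulVec_skew (tensorP_transpose c), hα, dotProduct_zero, neg_zero]
    rw [mulVecLin_apply] at hβ
    rw [hβ, dotProduct_sub, dotProduct_smul, sub_eq_zero] at h0
    rw [h0, smul_dotProduct, smul_eq_mul, smul_eq_mul]
    ring
  rw [dotProduct_eq _ _ h, mulVec_smul, tensorQdef_mulVec_logVol hc, smul_zero]

theorem exists_recursionOperator (hk : 1 ≤ k) {c : Config k} (hc : c ∈ phaseSpace k) :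
    ∃ N : charSpace (tensorP k) c →ₗ[ℝ] charSpace (tensorP k) c,
      IsRecursionOperator (tensorP k) (tensorQdef k) c N := by
  -- A linear choice of preimages under P; its ambiguity lies in ker P and is killed by Q̃.
  obtain ⟨s, hs⟩ := (tensorP k c).mulVecLin.rangeRestrict.exists_rightInverse_of_surjective
    (LinearMap.range_eq_top.2 (LinearMap.surjective_rangeRestrict _))
  refine ⟨((tensorQdef k c).mulVecLin ∘ₗ s).codRestrict _ fun v => ?_, fun α => ?_⟩
  · rw [mem_charSpace_iff hk hc]
    exact logVol_dotProduct_tensorQdef hc _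
  · change tensorQdef k c *ᵥ s ((tensorP k c).mulVecLin.rangeRestrict α) = _
    rw [← sub_eq_zero, ← mulVec_sub]
    refine tensorQdef_mulVec_eq_zero hk hc ?_
    have h := congrArg Subtype.val
      (LinearMap.congr_fun hs ((tensorP k c).mulVecLin.rangeRestrict α))
    rw [mulVec_sub, sub_eq_zero]
    exact h

/-- Tangent curves preserve c_1⋯c_n. Conversely, in the coordinates log c_i a level set is an affine
hyperplane, and the segment between two of its points is a tangent curve. -/
theorem symplecticLeaf_eq (hk : 1 ≤ k) {c₀ : Config k} (hc₀ : c₀ ∈ phaseSpace k) :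
    symplecticLeaf (tensorP k) (phaseSpace k) c₀ =
      {c | c ∈ phaseSpace k ∧ ∏ i, c i = ∏ i, c₀ i} := by
  ext c
  constructor
  · rintro ⟨γ, hγ, rfl, rfl, h⟩
    refine ⟨(h 1 ⟨zero_le_one, le_rfl⟩).1, ?_⟩
    have hd (t : ℝ) (ht : t ∈ Set.Icc (0 : ℝ) 1) : HasDerivAt (fun t => ∏ i, γ t i) 0 t := by
      obtain ⟨h1, h2⟩ := h t ht
      have h3 := (contDiff_prod_univ.differentiable (by simp) (γ t) :
        DifferentiableAt ℝ (fun c : Config k => ∏ i, c i) (γ t)).hasFDerivAt.comp_hasDerivAt t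
          ((hγ.differentiable (by simp) t).hasDerivAt)
      rwa [fderiv_prod_univ h1, (mem_charSpace_iff hk h1 _).1 h2, mul_zero] at h3
    exact constant_of_has_deriv_right_zero (f := fun t => ∏ i, γ t i) (a := 0) (b := 1)
      (fun t ht => (hd t ht).continuousAt.continuousWithinAt)
      (fun t ht => (hd t (Set.Ico_subset_Icc_self ht)).hasDerivWithinAt) 1 ⟨zero_le_one, le_rfl⟩
  · rintro ⟨hc, hprod⟩
    refine ⟨expCurve (fun i => Real.log (c i) - Real.log (c₀ i)) c₀, contDiff_expCurve _ _,
      expCurve_zero _ _, ?_, fun t _ => ?_⟩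
    · ext i
      have h0 := (hc₀ i).ne'
      simp only [expCurve, one_mul, Real.exp_sub, Real.exp_log (hc i), Real.exp_log (hc₀ i)]
      field_simp
    · have hγ := expCurve_mem_phaseSpace hc₀ (fun i => Real.log (c i) - Real.log (c₀ i)) t
      refine ⟨hγ, ?_⟩
      rw [(hasDerivAt_expCurve _ _ t).deriv, mem_charSpace_iff hk hγ]
      have hsum : ∑ i, (Real.log (c i) - Real.log (c₀ i)) = 0 := by
        rw [Finset.sum_sub_distrib, ← Real.log_prod fun i _ => (hc i).ne',
          ← Real.log_prod fun i _ => (hc₀ i).ne', hprod, sub_self]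
      rw [← hsum]
      refine Finset.sum_congr rfl fun i _ => ?_
      have := (hγ i).ne'
      simp only [logVol]
      field_simp

/-- The local inverse of `coordMap` is restricted to the slice on which the last coordinate has its
value at `c`. -/
theorem exists_chart (hk : 1 ≤ k) {c : Config k} (hc : c ∈ phaseSpace k) :
    ∃ (U : Set (Config k)) (V : Set ((Fin k → ℝ) × (Fin k → ℝ)))
      (g : (Fin k → ℝ) × (Fin k → ℝ) → Config k),
      IsOpen U ∧ c ∈ U ∧ IsOpen V ∧
      (∀ i, ContDiffOn ℝ ∞ (eta k i) U) ∧ (∀ i, ContDiffOn ℝ ∞ (psi k i) U) ∧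
      ContDiffOn ℝ ∞ g V ∧
      Set.MapsTo (fun p => (fun i => eta k i p, fun i => psi k i p))
        ({c' | c' ∈ phaseSpace k ∧ ∏ i, c' i = ∏ i, c i} ∩ U) V ∧
      Set.MapsTo g V ({c' | c' ∈ phaseSpace k ∧ ∏ i, c' i = ∏ i, c i} ∩ U) ∧
      Set.InvOn g (fun p => (fun i => eta k i p, fun i => psi k i p))
        ({c' | c' ∈ phaseSpace k ∧ ∏ i, c' i = ∏ i, c i} ∩ U) V := by
  obtain ⟨L, hL⟩ := exists_hasFDerivAt_coordMap hk hc
  set e := ((contDiffAt_coordMap hk hc).toOpenPartialHomeomorph (coordMap k) hL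
    (by simp)).restrOpen (phaseSpace k) isOpen_phaseSpace with he
  have hcoe (c' : Config k) : e c' = coordMap k c' := rfl
  have hsource : e.source ⊆ phaseSpace k := by
    rw [he, OpenPartialHomeomorph.restrOpen_source]
    exact Set.inter_subset_right
  have hce : c ∈ e.source := by
    rw [he, OpenPartialHomeomorph.restrOpen_source]
    exact ⟨(contDiffAt_coordMap hk hc).mem_toOpenPartialHomeomorph_source hL (by simp), hc⟩
  have hincl : ContDiff ℝ ∞ fun p : (Fin k → ℝ) × (Fin k → ℝ) => (p, ∏ i, c i) :=
    contDiff_id.prodMk contDiff_const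
  refine ⟨e.source, {p | (p, ∏ i, c i) ∈ e.target}, fun p => e.symm (p, ∏ i, c i), e.open_source,
    hce, e.open_target.preimage hincl.continuous,
    fun i c' hc' => (contDiffAt_eta hk (hsource hc') i).contDiffWithinAt,
    fun i c' hc' => (contDiffAt_psi hk (hsource hc') i).contDiffWithinAt, ?_, ?_, ?_, ?_, ?_⟩
  · intro p hp
    have hp' := hsource (e.map_target hp)
    obtain ⟨L', hL'⟩ := exists_hasFDerivAt_coordMap hk hp'
    have h := e.contDiffAt_symm hp hL' (contDiffAt_coordMap hk hp')
    exact (ContDiffAt.comp p h hincl.contDiffAt).contDiffWithinAt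
  · rintro c' ⟨⟨-, h2⟩, h3⟩
    have := e.map_source h3
    rw [hcoe, coordMap, h2] at this
    exact this
  · intro p hp
    have h1 := e.map_target hp
    have h2 : coordMap k (e.symm (p, ∏ i, c i)) = (p, ∏ i, c i) := e.right_inv hp
    exact ⟨⟨hsource h1, congrArg Prod.snd h2⟩, h1⟩
  · rintro c' ⟨⟨-, h2⟩, h3⟩
    have := e.left_inv h3
    rw [hcoe, coordMap, h2] at this
    exact this
  · intro p hp
    have h2 : coordMap k (e.symm (p, ∏ i, c i)) = (p, ∏ i, c i) := e.right_inv hp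
    exact congrArg Prod.fst h2

theorem isDarbouxNijenhuis (hk : 1 ≤ k) {c₀ : Config k} (hc₀ : c₀ ∈ phaseSpace k) :
    IsDarbouxNijenhuis (tensorP k) (tensorQdef k)
      (symplecticLeaf (tensorP k) (phaseSpace k) c₀) (root k) (eta k) (psi k) := by
  rw [symplecticLeaf_eq hk hc₀]
  refine ⟨?_, fun c hc => dotProduct_grad_eta_eta hk hc.1,
    fun c hc => dotProduct_grad_psi_psi hk hc.1, fun c hc => dotProduct_grad_psi_eta hk hc.1, ?_⟩
  · rintro c ⟨hc, hprod⟩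
    rw [← hprod]
    exact exists_chart hk hc
  · rintro c ⟨hc, -⟩
    obtain ⟨N, hN⟩ := exists_recursionOperator hk hc
    refine ⟨N, hN, fun i v => ?_⟩
    obtain ⟨α, rfl⟩ := LinearMap.surjective_rangeRestrict (tensorP k c).mulVecLin v
    rw [hN]
    simp only [fderiv_eq_dotProduct_grad]
    exact ⟨(isEigenform_eta hk hc i).dotProduct_eq α, (isEigenform_psi hk hc i).dotProduct_eq α⟩

end Volterra

theorem mainTheorem6 (k : ℕ) (hk : 1 ≤ k) :
    (∀ c ∈ Volterra.phaseSpace k,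
      0 < Volterra.lastCoeff k c ∧
      Volterra.fieldY k c =
        Pi.single 0 (c 0) - Pi.single (Fin.last (2 * k)) (c (Fin.last (2 * k)))) ∧
    (∀ c ∈ Volterra.phaseSpace k,
      Volterra.minPol k c =
        ∏ i : Fin k, (Polynomial.X - Polynomial.C (Volterra.root k i c)) ∧
      StrictMono (fun i : Fin k => Volterra.root k i c) ∧
      (∀ i : Fin k, 0 < Volterra.root k i c) ∧
      (∀ i : Fin k, Volterra.psiArg k i c ≠ 0)) ∧
    (∀ c₀ ∈ Volterra.phaseSpace k,
      Volterra.IsDarbouxNijenhuis (Volterra.tensorP k) (Volterra.tensorQdef k)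
        (Volterra.symplecticLeaf (Volterra.tensorP k) (Volterra.phaseSpace k) c₀)
        (Volterra.root k) (Volterra.eta k) (Volterra.psi k)) :=
  ⟨fun _ hc => ⟨Volterra.lastCoeff_pos hk hc, Volterra.fieldY_eq hk hc⟩,
    fun _ hc => ⟨(Volterra.root_spec hk hc).2, (Volterra.root_spec hk hc).1,
      Volterra.root_pos hk hc, Volterra.psiArg_ne_zero hk hc⟩,
    fun _ hc => Volterra.isDarbouxNijenhuis hk hc⟩
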